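/- For a finite family $\mathcal F$ of subsets of an $n$-element set $V$ and $T\subseteq V$ let $\mathcal F_{|T}=\{F\cap T: F\in\mathcal F\}$. Write $(n,m)\to(a,b)$ if for every family $\mathcal F\subseteq 2^V$ with $|V|=n$ and $|\mathcal F|\ge m$ there is an $a$-element set $T\subseteq V$ with $|\mathcal F_{|T}|\ge b$. For non-negative integers $n,s$ let $m(n,s)$ be the maximum integer $m\le 2^n$ such that $(n,m)\to(n-1,m-s)$, and let $m(s)=\lim_{n\to\infty} m(n,s)/n$. Then the limit $m(s)$ exists for every non-negative integer $s$. Moreover, for every integer $d\ge 50$, the largest integer $c_0=c_0(d)$ such that $$m(2^{d-1}-c)=\frac{2^d-c}{d}\qquad\text{for every } 1\le c\le c_0$$ is $c_0(d)=d-1$. -/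

import Mathlib

open Filter Topology

/-- The trace of the family `F` on `T`, namely `{A ∩ T : A ∈ F}`. -/
def traceOn {n : ℕ} (F : Finset (Finset (Fin n))) (T : Finset (Fin n)) :
    Finset (Finset (Fin n)) :=
  F.image (fun A => A ∩ T)

/-- The arrowing relation `(n, m) → (a, b)`: every family of at least `m` subsets of an
`n`-element set has at least `b` traces on some `a`-element set `T`. -/
def Arrows (n m a b : ℕ) : Prop :=
  ∀ F : Finset (Finset (Fin n)), m ≤ F.card →
    ∃ T : Finset (Fin n), T.card = a ∧ b ≤ (traceOn F T).card

/-- The `m` with `(n, m) → (n - 1, m - s)`. The range `m ≤ 2 ^ n` is that of the sizes of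
families of subsets of an `n`-element set: for `m > 2 ^ n` there are no families to consider
and the relation holds vacuously. (For `m < s` the requirement `|F|_T| ≥ m - s` is void, with
the truncated difference as well as with the integer one.) -/
def arrowSizes (n s : ℕ) : Set ℕ :=
  {m | m ≤ 2 ^ n ∧ Arrows n m (n - 1) (m - s)}

/-- `m(n, s)`: the maximum `m` such that `(n, m) → (n - 1, m - s)`. -/
noncomputable def maxArrow (n s : ℕ) : ℕ :=
  sSup (arrowSizes n s)

/-- The supremum defining `maxArrow` is a maximum. -/
theorem isGreatest_maxArrow (n s : ℕ) : IsGreatest (arrowSizes n s) (maxArrow n s) := by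
  have hb : BddAbove (arrowSizes n s) := ⟨2 ^ n, fun m hm => hm.1⟩
  have hne : (arrowSizes n s).Nonempty := by
    refine ⟨0, Nat.zero_le _, fun F _ => ?_⟩
    obtain ⟨T, -, hT⟩ := Finset.exists_subset_card_eq
      (s := (Finset.univ : Finset (Fin n))) (n := n - 1) (by simp)
    exact ⟨T, hT, by simp⟩
  exact ⟨Nat.sSup_mem hne hb, fun m hm => le_csSup hb hm⟩

/-- `m(s) = lim_{n → ∞} m(n, s) / n`. -/
noncomputable def arrowLimit (s : ℕ) : ℝ :=
  limUnder atTop (fun n : ℕ => (maxArrow n s : ℝ) / (n : ℝ))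

/-! Down-compression keeps the size of a family and enlarges no trace, so only lower families
matter. In a lower family, deleting a point x loses exactly the members containing x. Hence for
large n, `maxArrow n s` is the least number of nonempty members of a lower family with all degrees
above s (`maxArrow_le_of_hasLower`, `hasLower_maxArrow`). Gluing such families along ∅ makes this
subadditive, so the limit exists, and a single example on n points with j nonempty members bounds it
by j / n. The cube on d points with c - 1 sets removed gives the upper bound.

For the lower bound let K = c - 1 and τ = (2^d - 1 - K) / d. Spread every nonempty member A evenly
over its points, so that x receives the sum of 1 / |A| over the members A containing x; the average
must be at least τ. A point with more than d points in its closed neighbourhood receives τ by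
itself: this is Katona's theorem on the link, sharpened by the gain from one superfluous singleton
(`initialWeight_add_le_sum`). The remaining, tight points have closed neighbourhoods of exactly d
points, called blocks. The weight inside a block B falls short of dτ by the number of missing
subsets of B minus K. Double counting (`card_sub_le_sum_of_degree_le`) bounds this deficit by shares
charged to the non-tight points of B, and these can pay with members that leave B
(`IsDense.sum_share_le`). `IsDense.card_mul_le` adds everything up.

For c = d, two blocks with d missing sets each, joined by an edge, beat the single cube. -/

/-! ### Weights of intervals under the binary digit sum -/

/-- The number of ones in the binary expansion of a natural number. -/
def binWeight : ℕ → ℕ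
  | 0 => 0
  | n + 1 => (n + 1) % 2 + binWeight ((n + 1) / 2)
decreasing_by omega

theorem binWeight_zero : binWeight 0 = 0 := by rw [binWeight]

theorem binWeight_eq (n : ℕ) : binWeight n = n % 2 + binWeight (n / 2) := by
  cases n with
  | zero => simp [binWeight_zero]
  | succ n => rw [binWeight]

theorem binWeight_two_pow_add {k i : ℕ} (h : i < 2 ^ k) :
    binWeight (2 ^ k + i) = binWeight i + 1 := by
  induction k generalizing i with
  | zero =>
    obtain rfl : i = 0 := by simpa using h
    rw [binWeight_eq]
    simp [binWeight_zero]
  | succ k ih =>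
    rw [pow_succ] at h ⊢
    rw [binWeight_eq, binWeight_eq i, show (2 ^ k * 2 + i) / 2 = 2 ^ k + i / 2 by omega,
      ih (by omega)]
    omega

theorem binWeight_compl {k i : ℕ} (h : i < 2 ^ k) :
    binWeight (2 ^ k - 1 - i) + binWeight i = k := by
  induction k generalizing i with
  | zero =>
    obtain rfl : i = 0 := by simpa using h
    simp [binWeight_zero]
  | succ k ih =>
    rw [pow_succ] at h ⊢
    rw [binWeight_eq, binWeight_eq i, show (2 ^ k * 2 - 1 - i) / 2 = 2 ^ k - 1 - i / 2 by omega]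
    have := ih (i := i / 2) (by omega)
    omega

theorem binWeight_succ_le (n : ℕ) : binWeight (n + 1) ≤ binWeight n + 1 := by
  induction n using Nat.strong_induction_on with
  | _ n ih =>
    rw [binWeight_eq, binWeight_eq n]
    rcases Nat.even_or_odd' n with ⟨m, rfl | rfl⟩
    · rw [show (2 * m + 1) / 2 = 2 * m / 2 by omega]
      omega
    · rw [show (2 * m + 1 + 1) / 2 = m + 1 by omega, show (2 * m + 1) / 2 = m by omega]
      have := ih m (by omega)
      omega

theorem antitone_comp_succ {f : ℕ → ℝ} (hf : Antitone f) : Antitone fun t => f (t + 1) :=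
  fun _ _ h => hf (by omega)

/-- Sum of `f ∘ binWeight` over an interval of length `b` starting at `a`. -/
noncomputable def intervalWeight (f : ℕ → ℝ) (a b : ℕ) : ℝ :=
  ∑ i ∈ Finset.range b, f (binWeight (a + i))

theorem intervalWeight_add (f : ℕ → ℝ) (a b c : ℕ) :
    intervalWeight f a (b + c) = intervalWeight f a b + intervalWeight f (a + b) c := by
  simp [intervalWeight, Finset.sum_range_add, add_assoc]

theorem intervalWeight_two_pow_add (f : ℕ → ℝ) {k a b : ℕ} (h : a + b ≤ 2 ^ k) :
    intervalWeight f (2 ^ k + a) b = intervalWeight (fun t => f (t + 1)) a b := by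
  refine Finset.sum_congr rfl fun i hi => ?_
  rw [add_assoc, binWeight_two_pow_add (by rw [Finset.mem_range] at hi; omega)]

theorem intervalWeight_reflect (f : ℕ → ℝ) {k a b : ℕ} (h : a + b ≤ 2 ^ k) :
    intervalWeight f a b = intervalWeight (fun t => f (k - t)) (2 ^ k - (a + b)) b := by
  unfold intervalWeight
  rw [← Finset.sum_range_reflect]
  refine Finset.sum_congr rfl fun i hi => ?_
  rw [Finset.mem_range] at hi
  have := binWeight_compl (k := k) (i := 2 ^ k - (a + b) + i) (by omega)
  rw [show 2 ^ k - 1 - (2 ^ k - (a + b) + i) = a + (b - 1 - i) by omega] at this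
  exact congrArg f (by omega)

theorem intervalWeight_mono {f g : ℕ → ℝ} (h : ∀ t, f t ≤ g t) (a b : ℕ) :
    intervalWeight f a b ≤ intervalWeight g a b :=
  Finset.sum_le_sum fun _ _ => h _

/-- Cancelling the common part of two intervals. -/
theorem intervalWeight_le_of_overlap (f : ℕ → ℝ) {a b p : ℕ} (h : a ≤ b)
    (hK : intervalWeight f (p + b) a ≤ intervalWeight f p a) :
    intervalWeight f (p + a) b ≤ intervalWeight f p b := by
  obtain ⟨c, rfl⟩ := Nat.exists_eq_add_of_le h
  have h1 := intervalWeight_add f p a c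
  have h2 := intervalWeight_add f (p + a) c a
  rw [add_comm a c] at h1 hK ⊢
  rw [add_assoc p a c, add_comm a c] at h2
  linarith

/-- Induction on a + b. An interval between consecutive powers of two loses its leading bit. One
straddling `2 ^ (k + 1)` is split there: the upper piece equals the first v terms on the right, and
complementing digits turns the rest into the same claim for `fun t => -f (k + 2 - t)` with a smaller
a + b. -/
theorem intervalWeight_le_shift {f : ℕ → ℝ} (hf : Antitone f) {a b : ℕ} (h : b ≤ a) :
    intervalWeight f a b ≤ intervalWeight (fun t => f (t + 1)) 0 b := by
  induction hN : a + b using Nat.strong_induction_on generalizing a b f with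
  | _ N ih =>
    rcases Nat.eq_zero_or_pos b with rfl | hb
    · simp [intervalWeight]
    have ha : a ≠ 0 := by omega
    obtain ⟨k, hk⟩ : ∃ k, k = Nat.log 2 a := ⟨_, rfl⟩
    have hk1 : 2 ^ k ≤ a := hk ▸ Nat.pow_log_le_self 2 ha
    have hk2 : a < 2 ^ (k + 1) := hk ▸ Nat.lt_pow_succ_log_self (by norm_num) a
    have h2 : 2 ^ (k + 1) = 2 ^ k + 2 ^ k := by ring
    rcases le_or_gt (a + b) (2 ^ (k + 1)) with hab | hab
    · obtain ⟨a', rfl⟩ := Nat.exists_eq_add_of_le hk1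
      rw [intervalWeight_two_pow_add f (by omega)]
      have hf1 := antitone_comp_succ hf
      rcases le_total b a' with hba | hba
      · refine (ih (a' + b) (by omega) hf1 hba rfl).trans ?_
        exact intervalWeight_mono (fun t => hf1 (by omega)) _ _
      · have := intervalWeight_le_of_overlap (fun t => f (t + 1)) (p := 0) hba
        simp only [zero_add] at this
        refine this ((ih (b + a') (by omega) hf1 hba rfl).trans ?_)
        exact intervalWeight_mono (fun t => hf1 (by omega)) _ _
    · obtain ⟨u, hu⟩ := Nat.exists_eq_add_of_le hk2.le
      obtain ⟨v, rfl⟩ := Nat.exists_eq_add_of_le (show u ≤ b by omega)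
      rw [intervalWeight_add, ← hu, add_comm u v, intervalWeight_add _ 0 v u, zero_add]
      have e1 : intervalWeight f (2 ^ (k + 1)) v = intervalWeight (fun t => f (t + 1)) 0 v := by
        have := intervalWeight_two_pow_add f (k := k + 1) (a := 0) (b := v) (by omega)
        simpa using this
      have e2 : intervalWeight f a u = intervalWeight (fun t => f (k + 1 - t)) 0 u := by
        rw [intervalWeight_reflect f (k := k + 1) (by omega), hu, Nat.sub_self]
      have e3 := intervalWeight_reflect (fun t => f (t + 1)) (k := k + 1) (a := v) (b := u)
        (by omega)
      have hg : Antitone fun t => -f (k + 2 - t) := fun x y hxy => by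
        simpa using hf (show k + 2 - y ≤ k + 2 - x by omega)
      have key := ih (2 ^ (k + 1) - (v + u) + u) (by omega) hg
        (a := 2 ^ (k + 1) - (v + u)) (b := u) (by omega) rfl
      have e4 : intervalWeight (fun t => f (k + 1 - t + 1)) (2 ^ (k + 1) - (v + u)) u
          = - intervalWeight (fun t => -f (k + 2 - t)) (2 ^ (k + 1) - (v + u)) u := by
        rw [intervalWeight, intervalWeight, ← Finset.sum_neg_distrib]
        refine Finset.sum_congr rfl fun i hi => ?_
        rw [Finset.mem_range] at hi
        have := binWeight_compl (k := k + 1) (i := 2 ^ (k + 1) - (v + u) + i) (by omega)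
        rw [neg_neg]
        congr 1
        omega
      have e5 : intervalWeight (fun t => -f (k + 2 - (t + 1))) 0 u
          = - intervalWeight (fun t => f (k + 1 - t)) 0 u := by
        rw [intervalWeight, intervalWeight, ← Finset.sum_neg_distrib]
        refine Finset.sum_congr rfl fun i hi => ?_
        congr 2
        omega
      rw [e4] at e3
      rw [e5] at key
      linarith

/-- Among intervals not containing `0`, the one starting at `1` has the largest weight. -/
theorem intervalWeight_le_one {f : ℕ → ℝ} (hf : Antitone f) {a : ℕ} (ha : 1 ≤ a) (b : ℕ) :
    intervalWeight f a b ≤ intervalWeight f 1 b := by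
  have step : ∀ c, intervalWeight (fun t => f (t + 1)) 0 c ≤ intervalWeight f 1 c := fun c =>
    Finset.sum_le_sum fun i _ => hf (by
      rw [zero_add, add_comm]; exact binWeight_succ_le i)
  rcases le_total b a with h | h
  · exact (intervalWeight_le_shift hf h).trans (step b)
  · obtain ⟨a, rfl⟩ := Nat.exists_eq_add_of_le ha
    exact intervalWeight_le_of_overlap f (by omega)
      ((intervalWeight_le_shift hf (by omega)).trans (step a))

/-- The recursion behind Katona's theorem: a and b stand for the sizes of the deletion and the link
at a point, and the sets of the link grow by one when the point is put back. -/
theorem initialWeight_add_le {f : ℕ → ℝ} (hf : Antitone f) {a b : ℕ} (h : b ≤ a) :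
    intervalWeight f 0 (a + b) ≤
      intervalWeight f 0 a + intervalWeight (fun t => f (t + 1)) 0 b := by
  rw [intervalWeight_add, zero_add]
  linarith [intervalWeight_le_shift hf h]

/-- The indices from a on share the leading bit `2 ^ D`. Once stripped of it they avoid 0, because a
exceeds `2 ^ D`, so `intervalWeight_le_one` leaves the index 0 free to pay for `f 1`. -/
theorem initialWeight_add_le_of_two_pow_lt {f : ℕ → ℝ} (hf : Antitone f) {D a b : ℕ}
    (ha : 2 ^ D < a) (hb : 1 ≤ b) (hab : a + b ≤ 2 ^ (D + 1)) :
    intervalWeight f 0 (a + b - 1) + f 1 ≤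
      intervalWeight f 0 a + intervalWeight (fun t => f (t + 1)) 0 b := by
  obtain ⟨a', rfl⟩ := Nat.exists_eq_add_of_le ha.le
  obtain ⟨b, rfl⟩ := Nat.exists_eq_add_of_le hb
  rw [show 2 ^ D + a' + (1 + b) - 1 = 2 ^ D + a' + b by omega, intervalWeight_add, zero_add,
    intervalWeight_add _ 0 1 b, intervalWeight_two_pow_add f (by rw [pow_succ] at hab; omega)]
  have := intervalWeight_le_one (antitone_comp_succ hf) (show 1 ≤ a' by omega) b
  have h1 : intervalWeight (fun t => f (t + 1)) 0 1 = f 1 := by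
    simp [intervalWeight, binWeight_zero]
  rw [zero_add, h1]
  linarith

/-! ### Katona's theorem and its sharpening -/

section LowerFamilies

variable {α : Type*} [DecidableEq α]

theorem sum_card_eq_add (f : ℕ → ℝ) (L : Finset (Finset α)) (v : α) :
    ∑ A ∈ L, f A.card =
      ∑ A ∈ L.nonMemberSubfamily v, f A.card + ∑ A ∈ L.memberSubfamily v, f (A.card + 1) := by
  rw [← Finset.sum_filter_add_sum_filter_not L (fun A => v ∈ A), add_comm]
  congr 1
  rw [Finset.memberSubfamily, Finset.sum_image]
  · refine Finset.sum_congr rfl fun A hA => ?_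
    rw [Finset.card_erase_add_one (Finset.mem_filter.1 hA).2]
  · intro A hA B hB h
    exact Finset.erase_injOn' v (Finset.mem_filter.1 hA).2 (Finset.mem_filter.1 hB).2 h

/-- **Katona's theorem** on the weight of lower families. -/
theorem initialWeight_le_sum {f : ℕ → ℝ} (hf : Antitone f) {L : Finset (Finset α)}
    (hL : IsLowerSet (L : Set (Finset α))) :
    intervalWeight f 0 L.card ≤ ∑ A ∈ L, f A.card := by
  induction hN : L.card using Nat.strong_induction_on generalizing L f with
  | _ N ih =>
    by_cases h : ∃ v, {v} ∈ L
    · obtain ⟨v, hv⟩ := h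
      have hs := Finset.card_memberSubfamily_add_card_nonMemberSubfamily v L
      have h1 : 0 < (L.memberSubfamily v).card :=
        Finset.card_pos.2 ⟨∅, by simpa [Finset.mem_memberSubfamily] using hv⟩
      have hle := Finset.card_le_card (hL.memberSubfamily_subset_nonMemberSubfamily (a := v))
      have i0 := ih _ (by omega) hf (hL.nonMemberSubfamily (a := v)) rfl
      have i1 := ih _ (by omega) (antitone_comp_succ hf) (hL.memberSubfamily (a := v)) rfl
      rw [sum_card_eq_add f L v, ← hN, ← hs, add_comm]
      exact (initialWeight_add_le hf hle).trans (add_le_add i0 i1)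
    · have hsub : L ⊆ {∅} := fun A hA => by
        rw [Finset.mem_singleton]
        by_contra hne
        obtain ⟨v, hv⟩ := Finset.nonempty_iff_ne_empty.2 hne
        exact h ⟨v, hL (Finset.singleton_subset_iff.2 hv) hA⟩
      rcases Finset.subset_singleton_iff.1 hsub with rfl | rfl
      · simp at hN; subst hN; simp [intervalWeight]
      · simp at hN; subst hN; simp [intervalWeight, binWeight_zero]

/-- Otherwise L is closed under inserting points of V and contains the whole power set of V. -/
theorem exists_card_memberSubfamily_lt {L : Finset (Finset α)}
    (hL : IsLowerSet (L : Set (Finset α))) {V : Finset α} (hV : ∀ v ∈ V, {v} ∈ L)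
    (hne : V.Nonempty) (hcard : L.card < 2 ^ V.card) :
    ∃ v ∈ V, (L.memberSubfamily v).card < (L.nonMemberSubfamily v).card := by
  by_contra! hcon
  have key : ∀ v ∈ V, ∀ A ∈ L, insert v A ∈ L := fun v hv A hA => by
    by_cases hvA : v ∈ A
    · rwa [Finset.insert_eq_of_mem hvA]
    · have := Finset.eq_of_subset_of_card_le
        (hL.memberSubfamily_subset_nonMemberSubfamily (a := v)) (hcon v hv)
      have hA' : A ∈ L.nonMemberSubfamily v := Finset.mem_nonMemberSubfamily.2 ⟨hA, hvA⟩
      rw [← this] at hA'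
      exact (Finset.mem_memberSubfamily.1 hA').1
  have hall : ∀ S : Finset α, S ⊆ V → S ∈ L := fun S => by
    induction S using Finset.induction_on with
    | empty =>
      intro _
      obtain ⟨v, hv⟩ := hne
      exact hL (Finset.empty_subset {v}) (hV v hv)
    | insert a S _ ih =>
      intro hS
      exact key a (hS (Finset.mem_insert_self a S)) S
        (ih ((Finset.subset_insert a S).trans hS))
  have : V.powerset ⊆ L := fun S hS => hall S (Finset.mem_powerset.1 hS)
  have := Finset.card_le_card this
  rw [Finset.card_powerset] at this
  omega

/-- A lower family of at most `2 ^ D` sets on more than `D` points weighs at least as much as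
an initial segment together with an additional singleton. -/
theorem initialWeight_add_le_sum {f : ℕ → ℝ} (hf : Antitone f) {L : Finset (Finset α)}
    (hL : IsLowerSet (L : Set (Finset α))) {V : Finset α} (hV : ∀ v ∈ V, {v} ∈ L) {D : ℕ}
    (hD : D + 1 ≤ V.card) (hcard : L.card ≤ 2 ^ D) :
    intervalWeight f 0 (L.card - 1) + f 1 ≤ ∑ A ∈ L, f A.card := by
  induction hN : L.card using Nat.strong_induction_on generalizing L V D with
  | _ N ih =>
    have hVne : V.Nonempty := Finset.card_pos.1 (by omega)
    have hpow : 2 ^ D < 2 ^ V.card := Nat.pow_lt_pow_right (by norm_num) (by omega)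
    obtain ⟨v, hvV, hlt⟩ := exists_card_memberSubfamily_lt hL hV hVne (by omega)
    have hs := Finset.card_memberSubfamily_add_card_nonMemberSubfamily v L
    have h1 : 0 < (L.memberSubfamily v).card :=
      Finset.card_pos.2 ⟨∅, by simpa [Finset.mem_memberSubfamily] using hV v hvV⟩
    have i1 := initialWeight_le_sum (antitone_comp_succ hf) (hL.memberSubfamily (a := v))
    obtain _ | D := D
    · simp at hcard; omega
    rw [sum_card_eq_add f L v]
    -- A small deletion keeps the superfluous singleton, and strictness lets the link be appended to
    -- one index fewer. For a large deletion the gain comes from the leading bit instead.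
    rcases le_or_gt (L.nonMemberSubfamily v).card (2 ^ D) with ha | ha
    · have i0 := ih _ (by omega) (hL.nonMemberSubfamily (a := v)) (V := V.erase v) (D := D)
        (fun w hw => Finset.mem_nonMemberSubfamily.2 ⟨hV w (Finset.mem_of_mem_erase hw), by
          simpa using (Finset.ne_of_mem_erase hw).symm⟩)
        (by rw [Finset.card_erase_of_mem hvV]; omega) ha rfl
      have := initialWeight_add_le hf
        (show (L.memberSubfamily v).card ≤ (L.nonMemberSubfamily v).card - 1 by omega)
      rw [show (L.nonMemberSubfamily v).card - 1 + (L.memberSubfamily v).card = N - 1 by omega]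
        at this
      linarith
    · have i0 := initialWeight_le_sum hf (hL.nonMemberSubfamily (a := v))
      have := initialWeight_add_le_of_two_pow_lt hf ha h1 (by omega)
      rw [show (L.nonMemberSubfamily v).card + (L.memberSubfamily v).card - 1 = N - 1 by omega]
        at this
      linarith

/-- Lower families interpolate: between two nested ones there is one of every size. -/
theorem exists_lower_between {L₁ L₂ : Finset (Finset α)}
    (h₁ : IsLowerSet (L₁ : Set (Finset α))) (h₂ : IsLowerSet (L₂ : Set (Finset α)))
    (hsub : L₁ ⊆ L₂) {k : ℕ} (hk₁ : L₁.card ≤ k) (hk₂ : k ≤ L₂.card) :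
    ∃ L : Finset (Finset α), IsLowerSet (L : Set (Finset α)) ∧ L₁ ⊆ L ∧ L ⊆ L₂ ∧ L.card = k := by
  induction k, hk₁ using Nat.le_induction with
  | base => exact ⟨L₁, h₁, subset_rfl, hsub, rfl⟩
  | succ k _ ih =>
    obtain ⟨L, hL, hL₁, hL₂, hc⟩ := ih (by omega)
    have hne : (L₂ \ L).Nonempty := Finset.card_pos.1 (by
      rw [Finset.card_sdiff_of_subset hL₂]; omega)
    -- A smallest set outside L has all its proper subsets in L, so adding it preserves lowerness.
    obtain ⟨A, hA, hmin⟩ := Finset.exists_min_image _ Finset.card hne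
    rw [Finset.mem_sdiff] at hA
    refine ⟨insert A L, ?_, hL₁.trans (Finset.subset_insert _ _),
      Finset.insert_subset hA.1 hL₂, by rw [Finset.card_insert_of_notMem hA.2, hc]⟩
    intro B C hCB hB
    rw [Finset.mem_coe, Finset.mem_insert] at hB ⊢
    rcases hB with rfl | hB
    · by_contra! hcon
      have h3 := hmin C (Finset.mem_sdiff.2 ⟨h₂ hCB hA.1, hcon.2⟩)
      exact hcon.1 (Finset.eq_of_subset_of_card_le hCB h3)
    · exact Or.inr (hL hCB hB)

end LowerFamilies

/-! ### Double counting the missing sets of a block -/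

section Blocks

variable {V : Type*} [DecidableEq V]

theorem sum_card_filter_mem_add (M : Finset (Finset V)) (Q : Finset V) :
    ∑ y ∈ Q, (M.filter (y ∈ ·)).card + ∑ S ∈ M, (Q \ S).card = M.card * Q.card := by
  have h : ∑ y ∈ Q, (M.filter (y ∈ ·)).card = ∑ S ∈ M, (Q ∩ S).card := by
    simp only [Finset.card_filter]
    rw [Finset.sum_comm]
    refine Finset.sum_congr rfl fun S _ => ?_
    rw [← Finset.card_filter, Finset.filter_mem_eq_inter]
  rw [h, ← Finset.sum_add_distrib, Finset.sum_congr rfl fun S _ => Finset.card_inter_add_card_sdiff Q S]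
  simp

/-- An upward closed family of large subsets of `B` whose degrees at the points of `T` are at
most `K` cannot have many more than `K` members: the excess is bounded by a sum over the other
points of `B`. -/
theorem card_sub_le_sum_of_degree_le {B T : Finset V} {M : Finset (Finset V)} {K l : ℕ}
    (hT : T ⊆ B) (hMB : ∀ S ∈ M, S ⊆ B)
    (hup : ∀ S ∈ M, ∀ S', S ⊆ S' → S' ⊆ B → S' ∈ M) (hK : K + 2 ≤ B.card)
    (hdeg : ∀ x ∈ T, (M.filter (x ∈ ·)).card ≤ K) (hcodim : ∀ S ∈ M, (B \ S).card ≤ l)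
    (hl1 : 1 ≤ l) (hl : 7 * l + 2 ≤ B.card) {e : V → ℝ}
    (he1 : ∀ y ∈ B \ T, 1 / 2 ≤ e y)
    (he2 : ∀ y ∈ B \ T, ((M.filter (y ∈ ·)).card : ℝ) - K ≤ e y * (l + 2)) :
    (M.card : ℝ) - K ≤ ∑ y ∈ B \ T, e y := by
  have hhalf : ((B \ T).card : ℝ) / 2 ≤ ∑ y ∈ B \ T, e y := by
    have := Finset.card_nsmul_le_sum (B \ T) e (1 / 2) he1
    rw [nsmul_eq_mul] at this
    linarith
  by_cases hmK : M.card ≤ K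
  · have h1 : (M.card : ℝ) ≤ K := by exact_mod_cast hmK
    have h2 : (0 : ℝ) ≤ ((B \ T).card : ℝ) := Nat.cast_nonneg _
    linarith
  push Not at hmK
  have hBM : B ∈ M := by
    obtain ⟨S, hS⟩ := Finset.card_pos.1 (show 0 < M.card by omega)
    exact hup S hS B (hMB S hS) subset_rfl
  -- Otherwise every member contains x and the degree bound at x gives |M| ≤ K.
  have herase : ∀ x ∈ T, B.erase x ∈ M := fun x hx => by
    by_contra hcon
    have : M.filter (x ∈ ·) = M := Finset.filter_true_of_mem fun S hS => by
      by_contra hxS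
      exact hcon (hup S hS _ (Finset.subset_erase.2 ⟨hMB S hS, hxS⟩) (Finset.erase_subset _ _))
    have := hdeg x hx
    rw [‹M.filter (x ∈ ·) = M›] at this
    omega
  have hinj : ∀ U ⊆ T, (insert B (U.image (B.erase ·))).card = U.card + 1 := fun U hU => by
    rw [Finset.card_insert_of_notMem, Finset.card_image_of_injOn]
    · intro x hx y hy hxy
      exact Finset.erase_injOn B (hT (hU hx)) (hT (hU hy)) hxy
    · rw [Finset.mem_image]
      rintro ⟨x, hx, hxB⟩
      exact Finset.notMem_erase x B (hxB.symm ▸ hT (hU hx))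
  have htK : T.card ≤ K := by
    rcases T.eq_empty_or_nonempty with rfl | ⟨x, hx⟩
    · simp
    · refine le_trans ?_ (hdeg x hx)
      have h1 := hinj (T.erase x) (Finset.erase_subset _ _)
      rw [Finset.card_erase_of_mem hx] at h1
      have h2 : 0 < T.card := Finset.card_pos.2 ⟨x, hx⟩
      rw [show T.card = T.card - 1 + 1 by omega, ← h1]
      refine Finset.card_le_card fun S hS => ?_
      rw [Finset.mem_insert, Finset.mem_image] at hS
      rw [Finset.mem_filter]
      rcases hS with rfl | ⟨y, hy, rfl⟩
      · exact ⟨hBM, hT hx⟩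
      · exact ⟨herase y (Finset.mem_of_mem_erase hy),
          Finset.mem_erase.2 ⟨(Finset.ne_of_mem_erase hy).symm, hT hx⟩⟩
  have hspM : insert B (T.image (B.erase ·)) ⊆ M := by
    refine Finset.insert_subset hBM fun S hS => ?_
    obtain ⟨x, hx, rfl⟩ := Finset.mem_image.1 hS
    exact herase x hx
  have hsp := hinj T subset_rfl
  have hm := Finset.card_sdiff_add_card_eq_card hspM
  -- The set B and the sets `B.erase x` miss almost nothing; every other member misses at most l
  -- points.
  have hout : ∀ Q ⊆ B, ∑ S ∈ M, (Q \ S).card ≤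
      ∑ x ∈ T, (Q \ B.erase x).card + l * (M.card - (T.card + 1)) := fun Q hQ => by
    rw [← Finset.sum_sdiff hspM, add_comm]
    refine add_le_add ?_ ?_
    · rw [Finset.sum_insert, Finset.sum_image]
      · rw [Finset.sdiff_eq_empty_iff_subset.2 hQ]; simp
      · intro x hx y hy hxy
        exact Finset.erase_injOn B (hT hx) (hT hy) hxy
      · rw [Finset.mem_image]
        rintro ⟨x, hx, hxB⟩
        exact Finset.notMem_erase x B (hxB.symm ▸ hT hx)
    · have : ∀ S ∈ M \ insert B (T.image (B.erase ·)), (Q \ S).card ≤ l := fun S hS =>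
        (Finset.card_le_card (Finset.sdiff_subset_sdiff hQ subset_rfl)).trans
          (hcodim S (Finset.mem_sdiff.1 hS).1)
      refine (Finset.sum_le_card_nsmul _ _ _ this).trans ?_
      rw [smul_eq_mul, mul_comm]
      exact Nat.mul_le_mul le_rfl (by omega)
  have hr : (B \ T).card + T.card = B.card := Finset.card_sdiff_add_card_eq_card hT
  obtain ⟨p, hp⟩ := Nat.exists_eq_add_of_le (show T.card + 1 ≤ M.card by omega)
  obtain ⟨D, hDm⟩ := Nat.exists_eq_add_of_le hmK.le
  have hD1 : 1 ≤ D := by omega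
  rw [hDm]
  push_cast
  rw [add_sub_cancel_left]
  rw [show M.card - (T.card + 1) = p by omega] at hout
  suffices h : (2 * D ≤ (B \ T).card) ∨ ((l + 2 : ℝ) * D ≤ ∑ y ∈ B \ T, e y * (l + 2)) by
    rcases h with h | h
    · have : (2 * D : ℝ) ≤ ((B \ T).card : ℝ) := by exact_mod_cast h
      linarith
    · rw [← Finset.sum_mul, mul_comm] at h
      exact le_of_mul_le_mul_right h (by positivity)
  -- With t = |T| large, counting over T gives (D - 1)(t - l) ≤ l(K - t), hence 2(D - 1) ≤ K - t,
  -- and K + 2 ≤ |B| turns this into 2D ≤ |B \ T|.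
  by_cases ht : 3 * l ≤ T.card
  · left
    have h1 := sum_card_filter_mem_add M T
    have h2 := Finset.sum_le_card_nsmul T _ K hdeg
    have h3 := hout T hT
    have h4 : ∑ x ∈ T, (T \ B.erase x).card ≤ T.card := by
      have : ∀ x ∈ T, (T \ B.erase x).card ≤ 1 := fun x _ => by
        refine (Finset.card_le_card (t := {x}) fun y hy => ?_).trans (Finset.card_singleton x).le
        rw [Finset.mem_sdiff, Finset.mem_erase] at hy
        rw [Finset.mem_singleton]
        by_contra hne
        exact hy.2 ⟨hne, hT hy.1⟩
      simpa using Finset.sum_le_card_nsmul T _ 1 this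
    rw [smul_eq_mul] at h2
    have h5 : M.card * T.card ≤ T.card * K + T.card + l * p := by omega
    have h6 : (D - 1 : ℤ) * (T.card - l) ≤ l * (K - T.card) := by
      have hp' : (p : ℤ) = K + D - T.card - 1 := by omega
      have h7 : ((M.card : ℤ)) * T.card ≤ T.card * K + T.card + l * p := by exact_mod_cast h5
      rw [hp', hDm] at h7
      push_cast at h7
      nlinarith
    have h8 : (l : ℤ) * (2 * (D - 1)) ≤ l * (K - T.card) := by
      have : (0 : ℤ) ≤ (D - 1) * (T.card - 3 * l) := mul_nonneg (by omega) (by omega)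
      nlinarith
    have h9 := le_of_mul_le_mul_left h8 (by omega)
    omega
  -- With T small, count over B \ T, of which the sets `B.erase x` miss nothing. If r = |B \ T| ≥ 4l
  -- + 2 and 2D ≥ r, then Dr - l(D + r) ≥ (l + 2)D.
  · by_cases hDr : 2 * D ≤ (B \ T).card
    · exact Or.inl hDr
    right
    refine le_trans ?_ (Finset.sum_le_sum he2)
    have h1 := sum_card_filter_mem_add M (B \ T)
    have h3 := hout (B \ T) Finset.sdiff_subset
    have h4 : ∑ x ∈ T, ((B \ T) \ B.erase x).card = 0 := by
      refine Finset.sum_eq_zero fun x hx => ?_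
      rw [Finset.card_eq_zero, Finset.sdiff_eq_empty_iff_subset]
      intro y hy
      rw [Finset.mem_sdiff] at hy
      exact Finset.mem_erase.2 ⟨fun h => hy.2 (h ▸ hx), hy.1⟩
    rw [h4, zero_add] at h3
    rw [Finset.sum_sub_distrib, Finset.sum_const, nsmul_eq_mul]
    have h5 : M.card * (B \ T).card ≤ ∑ y ∈ B \ T, (M.filter (y ∈ ·)).card + l * p := by omega
    have h6 : ((M.card : ℝ)) * (B \ T).card ≤
        ∑ y ∈ B \ T, ((M.filter (y ∈ ·)).card : ℝ) + l * p := by exact_mod_cast h5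
    have h7 : (p : ℝ) ≤ D + (B \ T).card := by
      have : p ≤ D + (B \ T).card := by omega
      exact_mod_cast this
    have h8 : (4 * l + 2 : ℝ) ≤ (B \ T).card := by
      have : 4 * l + 2 ≤ (B \ T).card := by omega
      exact_mod_cast this
    have h9 : ((B \ T).card : ℝ) ≤ 2 * D := by
      have : (B \ T).card ≤ 2 * D := by omega
      exact_mod_cast this
    rw [hDm] at h6
    push_cast at h6
    have hl0 : (0 : ℝ) ≤ l := Nat.cast_nonneg _
    have h10 : (l : ℝ) * p ≤ l * (D + (B \ T).card) := mul_le_mul_of_nonneg_left h7 hl0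
    have h11 : (0 : ℝ) ≤ (2 * D - (B \ T).card) * ((B \ T).card - 2 * l - 2) :=
      mul_nonneg (by linarith) (by linarith)
    have h12 : (0 : ℝ) ≤ (B \ T).card * ((B \ T).card - 4 * l - 2) :=
      mul_nonneg (by positivity) (by linarith)
    nlinarith

end Blocks

/-! ### Numerical values for the weight 1 / (k + 1) -/

theorem intervalWeight_two_pow (f : ℕ → ℝ) (D : ℕ) :
    intervalWeight f 0 (2 ^ D) = ∑ A ∈ (Finset.range D).powerset, f A.card := by
  induction D generalizing f with
  | zero => simp [intervalWeight, binWeight_zero]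
  | succ D ih =>
    have h := intervalWeight_two_pow_add f (k := D) (a := 0) (b := 2 ^ D) (by omega)
    rw [add_zero] at h
    rw [pow_succ, mul_two, intervalWeight_add, zero_add, h, ih, ih,
      Finset.range_add_one, Finset.sum_powerset_insert Finset.notMem_range_self]
    congr 1
    refine Finset.sum_congr rfl fun A hA => ?_
    rw [Finset.card_insert_of_notMem fun h =>
      Finset.notMem_range_self (Finset.mem_powerset.1 hA h)]

theorem sum_powerset_one_div_card_add_one {α : Type*} (s : Finset α) :
    ∑ A ∈ s.powerset, 1 / ((A.card : ℝ) + 1) = (2 ^ (s.card + 1) - 1) / (s.card + 1) := by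
  rw [Finset.sum_powerset_apply_card fun k => 1 / ((k : ℝ) + 1), eq_div_iff (by positivity),
    Finset.sum_mul]
  have h1 : ∀ k ∈ Finset.range (s.card + 1),
      s.card.choose k • (1 / ((k : ℝ) + 1)) * (s.card + 1) = ((s.card + 1).choose (k + 1) : ℝ) := by
    intro k _
    have h := Nat.add_one_mul_choose_eq s.card k
    have h' : ((s.card : ℝ) + 1) * s.card.choose k = (s.card + 1).choose (k + 1) * (k + 1) := by
      exact_mod_cast h
    rw [nsmul_eq_mul]
    field_simp
    linarith
  rw [Finset.sum_congr rfl h1]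
  have h2 := Nat.sum_range_choose (s.card + 1)
  rw [Finset.sum_range_succ'] at h2
  have h3 : (∑ k ∈ Finset.range (s.card + 1), ((s.card + 1).choose (k + 1) : ℝ)) + 1
      = 2 ^ (s.card + 1) := by
    rw [Nat.choose_zero_right] at h2
    exact_mod_cast h2
  linarith

theorem antitone_one_div_add_one : Antitone fun k : ℕ => 1 / ((k : ℝ) + 1) := fun a b h => by
  have : (a : ℝ) ≤ b := by exact_mod_cast h
  exact one_div_le_one_div_of_le (by positivity) (by linarith)

/-- The K + 1 indices removed from the top of the cube have complements below `2 ^ l`, hence at most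
l zero digits, and weigh at most 1 / (d - l) each. -/
theorem initialWeight_two_pow_sub_ge {d K l : ℕ} (hK : K + 2 ≤ d) (hl : l + 1 ≤ d)
    (hpow : d ≤ 2 ^ l + 1) :
    ((2 : ℝ) ^ d - 1) / d - (K + 1) / (d - l) ≤
      intervalWeight (fun k : ℕ => 1 / ((k : ℝ) + 1)) 0 (2 ^ (d - 1) - (K + 1)) := by
  obtain ⟨D, rfl⟩ : ∃ D, d = D + 1 := ⟨d - 1, by omega⟩
  simp only [Nat.add_sub_cancel]
  have hD : D < 2 ^ D := Nat.lt_two_pow_self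
  have h1 := intervalWeight_two_pow (fun k : ℕ => 1 / ((k : ℝ) + 1)) D
  rw [sum_powerset_one_div_card_add_one, Finset.card_range] at h1
  have h2 := intervalWeight_add (fun k : ℕ => 1 / ((k : ℝ) + 1)) 0 (2 ^ D - (K + 1)) (K + 1)
  rw [Nat.sub_add_cancel (by omega), zero_add, h1,
    intervalWeight_reflect _ (k := D) (a := 2 ^ D - (K + 1)) (by omega)] at h2
  have h3 : intervalWeight (fun t : ℕ => 1 / (((D - t : ℕ) : ℝ) + 1))
      (2 ^ D - (2 ^ D - (K + 1) + (K + 1))) (K + 1) ≤ (K + 1) / ((D + 1 : ℝ) - l) := by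
    rw [show 2 ^ D - (2 ^ D - (K + 1) + (K + 1)) = 0 by omega]
    have h4 : ∀ i ∈ Finset.range (K + 1),
        1 / (((D - binWeight (0 + i) : ℕ) : ℝ) + 1) ≤ 1 / ((D + 1 : ℝ) - l) := fun i hi => by
      rw [Finset.mem_range] at hi
      have h5 := binWeight_compl (k := l) (i := 0 + i) (by omega)
      have h6 : (D : ℝ) ≤ ((D - binWeight (0 + i) : ℕ) : ℝ) + l := by
        have : D ≤ (D - binWeight (0 + i)) + l := by omega
        exact_mod_cast this
      have h7 : (l : ℝ) ≤ D := by exact_mod_cast (show l ≤ D by omega)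
      exact one_div_le_one_div_of_le (by linarith) (by linarith)
    refine (Finset.sum_le_card_nsmul _ _ _ h4).trans_eq ?_
    rw [Finset.card_range, nsmul_eq_mul]
    push_cast
    ring
  push_cast
  linarith

/-! ### Dense lower families and the structure of blocks -/

section Dense

variable {V : Type*} [DecidableEq V]

/-- The sum of `1 / |A|` over the members of `F` containing `x`. -/
noncomputable def pointWeight (F : Finset (Finset V)) (x : V) : ℝ :=
  ∑ A ∈ F.filter (x ∈ ·), 1 / (A.card : ℝ)

/-- The members of `F` inside `B`. -/
def inside (F : Finset (Finset V)) (B : Finset V) : Finset (Finset V) := F.filter (· ⊆ B)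

/-- The subsets of `B` missing from `F`. -/
def missing (F : Finset (Finset V)) (B : Finset V) : Finset (Finset V) :=
  B.powerset.filter (· ∉ F)

/-- The points that form a member of `F` together with `x`. -/
def closedNbhd [Fintype V] (F : Finset (Finset V)) (x : V) : Finset V :=
  Finset.univ.filter fun y => ({x, y} : Finset V) ∈ F

theorem mem_inside {F : Finset (Finset V)} {B A : Finset V} :
    A ∈ inside F B ↔ A ∈ F ∧ A ⊆ B := Finset.mem_filter

theorem mem_missing {F : Finset (Finset V)} {B A : Finset V} :
    A ∈ missing F B ↔ A ⊆ B ∧ A ∉ F := by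
  rw [missing, Finset.mem_filter, Finset.mem_powerset]

theorem mem_closedNbhd [Fintype V] {F : Finset (Finset V)} {x y : V} :
    y ∈ closedNbhd F x ↔ ({x, y} : Finset V) ∈ F := by
  simp [closedNbhd]

theorem sum_pointWeight {G : Finset (Finset V)} {B : Finset V} (h : ∀ A ∈ G, A ⊆ B) :
    ∑ x ∈ B, pointWeight G x = (G.erase ∅).card := by
  simp only [pointWeight, Finset.sum_filter]
  rw [Finset.sum_comm, Finset.card_eq_sum_ones, Nat.cast_sum]
  have h1 : ∀ A ∈ G, ∑ x ∈ B, (if x ∈ A then 1 / (A.card : ℝ) else 0) =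
      if A = ∅ then 0 else 1 := fun A hA => by
    rw [← Finset.sum_filter, Finset.filter_mem_eq_inter, Finset.inter_eq_right.2 (h A hA),
      Finset.sum_const, nsmul_eq_mul]
    split_ifs with hA0
    · simp [hA0]
    · have : (A.card : ℝ) ≠ 0 := by
        exact_mod_cast Finset.card_ne_zero.2 (Finset.nonempty_iff_ne_empty.2 hA0)
      field_simp
  rw [Finset.sum_congr rfl h1, Finset.erase_eq, ← Finset.filter_notMem_eq_sdiff, Finset.sum_filter]
  refine Finset.sum_congr rfl fun A _ => ?_
  by_cases hA : A = ∅ <;> simp [hA]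

theorem card_inside_add_card_missing (F : Finset (Finset V)) (B : Finset V) :
    (inside F B).card + (missing F B).card = 2 ^ B.card := by
  rw [← Finset.card_powerset, ← Finset.card_filter_add_card_filter_not (s := B.powerset) (· ∈ F)]
  congr 2
  ext A
  simp [mem_inside, and_comm]

theorem sum_powerset_filter_mem {B : Finset V} {y : V} (hy : y ∈ B) (f : ℕ → ℝ) :
    ∑ A ∈ B.powerset.filter (y ∈ ·), f A.card = ∑ A ∈ (B.erase y).powerset, f (A.card + 1) := by
  symm
  refine Finset.sum_bij' (fun A _ => insert y A) (fun A _ => A.erase y) ?_ ?_ ?_ ?_ ?_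
  · intro A hA
    rw [Finset.mem_powerset] at hA
    simp only [Finset.mem_filter, Finset.mem_powerset, Finset.mem_insert_self, and_true]
    exact Finset.insert_subset hy (hA.trans (Finset.erase_subset _ _))
  · intro A hA
    rw [Finset.mem_filter, Finset.mem_powerset] at hA
    exact Finset.mem_powerset.2 (Finset.erase_subset_erase _ hA.1)
  · intro A hA
    exact Finset.erase_insert fun h => Finset.notMem_erase y B (Finset.mem_powerset.1 hA h)
  · intro A hA
    exact Finset.insert_erase (Finset.mem_filter.1 hA).2
  · intro A hA
    rw [Finset.card_insert_of_notMem fun h => Finset.notMem_erase y B (Finset.mem_powerset.1 hA h)]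

theorem card_powerset_filter_mem {B : Finset V} {y : V} (hy : y ∈ B) :
    (B.powerset.filter (y ∈ ·)).card = 2 ^ (B.card - 1) := by
  have h := sum_powerset_filter_mem hy fun _ => 1
  simp only [Finset.sum_const, nsmul_eq_mul, mul_one, Finset.card_powerset,
    Finset.card_erase_of_mem hy] at h
  exact_mod_cast h

theorem card_inside_filter_mem {F : Finset (Finset V)} {B : Finset V} {y : V} (hy : y ∈ B) :
    ((inside F B).filter (y ∈ ·)).card + ((missing F B).filter (y ∈ ·)).card
      = 2 ^ (B.card - 1) := by
  rw [← card_powerset_filter_mem hy, ← Finset.card_filter_add_card_filter_not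
    (s := B.powerset.filter (y ∈ ·)) (· ∈ F)]
  congr 2
  · ext A
    simp only [mem_inside, Finset.mem_filter, Finset.mem_powerset]
    tauto
  · ext A
    simp only [mem_missing, Finset.mem_filter, Finset.mem_powerset]
    tauto

theorem pointWeight_inside {F : Finset (Finset V)} {B : Finset V} {y : V} (hy : y ∈ B) :
    pointWeight (inside F B) y + pointWeight (missing F B) y
      = ((2 : ℝ) ^ B.card - 1) / B.card := by
  have hpos := Finset.card_pos.2 ⟨y, hy⟩
  have h1 := sum_powerset_filter_mem hy fun k => 1 / (k : ℝ)
  have h2 := sum_powerset_one_div_card_add_one (B.erase y)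
  have h3 : ((B.erase y).card : ℝ) + 1 = B.card := by
    exact_mod_cast Finset.card_erase_add_one hy
  rw [h3, Finset.card_erase_add_one hy] at h2
  push_cast at h1
  rw [← h2, ← h1, ← Finset.sum_filter_add_sum_filter_not (B.powerset.filter (y ∈ ·)) (· ∈ F)]
  unfold pointWeight
  congr 1
  · refine Finset.sum_congr ?_ fun _ _ => rfl
    ext A
    simp only [mem_inside, Finset.mem_filter, Finset.mem_powerset]
    tauto
  · refine Finset.sum_congr ?_ fun _ _ => rfl
    ext A
    simp only [mem_missing, Finset.mem_filter, Finset.mem_powerset]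
    tauto

theorem pointWeight_nonneg (F : Finset (Finset V)) (x : V) : 0 ≤ pointWeight F x :=
  Finset.sum_nonneg fun _ _ => by positivity

theorem pointWeight_le_card (F : Finset (Finset V)) (x : V) :
    pointWeight F x ≤ (F.filter (x ∈ ·)).card := by
  have h : ∀ A ∈ F.filter (x ∈ ·), 1 / (A.card : ℝ) ≤ 1 := fun A hA => by
    have : 1 ≤ A.card := Finset.card_pos.2 ⟨x, (Finset.mem_filter.1 hA).2⟩
    have : (1 : ℝ) ≤ A.card := by exact_mod_cast this
    exact (div_le_one (by linarith)).2 this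
  simpa [pointWeight] using Finset.sum_le_card_nsmul _ _ _ h

theorem pointWeight_eq_sum_link (F : Finset (Finset V)) (x : V) :
    pointWeight F x = ∑ A ∈ F.memberSubfamily x, 1 / ((A.card : ℝ) + 1) := by
  rw [Finset.memberSubfamily, Finset.sum_image]
  · refine Finset.sum_congr rfl fun A hA => ?_
    rw [← Finset.card_erase_add_one (Finset.mem_filter.1 hA).2]
    push_cast
    rfl
  · intro A hA B hB hAB
    exact Finset.erase_injOn' x (Finset.mem_filter.1 hA).2 (Finset.mem_filter.1 hB).2 hAB

theorem card_memberSubfamily (F : Finset (Finset V)) (x : V) :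
    (F.memberSubfamily x).card = (F.filter (x ∈ ·)).card := by
  rw [Finset.memberSubfamily, Finset.card_image_of_injOn]
  intro A hA B hB hAB
  exact Finset.erase_injOn' x (Finset.mem_filter.1 hA).2 (Finset.mem_filter.1 hB).2 hAB

/-- Lower families in which every point has degree at least `2 ^ (d - 1) - K`, with the numerical
side conditions under which they are studied below. -/
structure IsDense (F : Finset (Finset V)) (d K l : ℕ) : Prop where
  lower : IsLowerSet (F : Set (Finset V))
  degree : ∀ x, 2 ^ (d - 1) ≤ (F.filter (x ∈ ·)).card + K
  le_d : 50 ≤ d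
  le_K : K + 2 ≤ d
  one_le_l : 1 ≤ l
  le_l : 7 * l + 2 ≤ d
  lt_pow : d ≤ 2 ^ l + 1

namespace IsDense

variable {F : Finset (Finset V)} {d K l : ℕ}

theorem five_mul_sq_le (h : IsDense F d K l) : 5 * d ^ 2 ≤ 2 ^ (d - 2) := by
  obtain ⟨D, rfl⟩ := Nat.exists_eq_add_of_le h.le_d
  rw [show 50 + D - 2 = 48 + D by omega]
  clear h
  induction D with
  | zero => norm_num
  | succ D ih =>
    have : (50 + D + 1) ^ 2 ≤ 2 * (50 + D) ^ 2 := by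
      clear ih
      ring_nf
      generalize D ^ 2 = E
      omega
    rw [← add_assoc, ← add_assoc, pow_succ 2]
    omega

theorem singleton_mem (h : IsDense F d K l) (x : V) : {x} ∈ F := by
  have h1 := h.degree x
  have h2 := h.five_mul_sq_le
  have h3 : 2 ^ (d - 2) ≤ 2 ^ (d - 1) := Nat.pow_le_pow_right (by norm_num) (by omega)
  have h4 := h.le_K
  have h5 := h.le_d
  obtain ⟨A, hA⟩ := Finset.card_pos.1 (show 0 < (F.filter (x ∈ ·)).card by nlinarith)
  rw [Finset.mem_filter] at hA
  exact h.lower (Finset.singleton_subset_iff.2 hA.2) hA.1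

theorem missing_up (h : IsDense F d K l) {B S S' : Finset V} (hS : S ∈ missing F B)
    (hSS : S ⊆ S') (hSB : S' ⊆ B) : S' ∈ missing F B := by
  rw [mem_missing] at hS ⊢
  exact ⟨hSB, fun hS' => hS.2 (h.lower hSS hS')⟩

variable [Fintype V]

theorem subset_closedNbhd (h : IsDense F d K l) {x : V} {A : Finset V} (hA : A ∈ F)
    (hx : x ∈ A) : A ⊆ closedNbhd F x := fun y hy => by
  rw [mem_closedNbhd]
  refine h.lower (?_ : ({x, y} : Finset V) ≤ A) hA
  exact Finset.insert_subset hx (Finset.singleton_subset_iff.2 hy)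

theorem self_mem_closedNbhd (h : IsDense F d K l) (x : V) : x ∈ closedNbhd F x := by
  rw [mem_closedNbhd, Finset.pair_eq_singleton]
  exact h.singleton_mem x

theorem le_card_closedNbhd (h : IsDense F d K l) (x : V) : d ≤ (closedNbhd F x).card := by
  by_contra! hlt
  have h1 : (F.filter (x ∈ ·)).card ≤ 2 ^ ((closedNbhd F x).card - 1) := by
    rw [← card_powerset_filter_mem (h.self_mem_closedNbhd x)]
    refine Finset.card_le_card fun A hA => ?_
    rw [Finset.mem_filter] at hA ⊢
    exact ⟨Finset.mem_powerset.2 (h.subset_closedNbhd hA.1 hA.2), hA.2⟩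
  have h2 : 2 ^ ((closedNbhd F x).card - 1) ≤ 2 ^ (d - 2) :=
    Nat.pow_le_pow_right (by norm_num) (by omega)
  have h3 := h.degree x
  have h4 := h.five_mul_sq_le
  have h5 := h.le_K
  have h6 := h.le_d
  rw [show d - 1 = d - 2 + 1 by omega, pow_succ] at h3
  nlinarith

theorem card_missing_filter_le (h : IsDense F d K l) {x : V} (hx : (closedNbhd F x).card = d) :
    ((missing F (closedNbhd F x)).filter (x ∈ ·)).card ≤ K := by
  have h1 := card_inside_filter_mem (F := F) (h.self_mem_closedNbhd x)
  have h2 : (inside F (closedNbhd F x)).filter (x ∈ ·) = F.filter (x ∈ ·) := by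
    ext A
    simp only [Finset.mem_filter, mem_inside]
    exact ⟨fun hA => ⟨hA.1.1, hA.2⟩, fun hA => ⟨⟨hA.1, h.subset_closedNbhd hA.1 hA.2⟩, hA.2⟩⟩
  have h3 := h.degree x
  rw [h2, hx] at h1
  omega

/-- Missing sets are closed upwards within the block, so inserting x injects those avoiding x into
those containing x. -/
theorem card_missing_le (h : IsDense F d K l) {x : V} (hx : (closedNbhd F x).card = d) :
    (missing F (closedNbhd F x)).card ≤ 2 * K := by
  have h1 := h.card_missing_filter_le hx
  rw [← Finset.card_filter_add_card_filter_not (x ∈ ·)]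
  have h2 : ((missing F (closedNbhd F x)).filter (x ∉ ·)).card ≤
      ((missing F (closedNbhd F x)).filter (x ∈ ·)).card := by
    refine Finset.card_le_card_of_injOn (insert x) (fun A hA => ?_) fun A hA B hB hAB => ?_
    · rw [Finset.mem_coe, Finset.mem_filter] at hA ⊢
      exact ⟨h.missing_up hA.1 (Finset.subset_insert _ _) (Finset.insert_subset
        (h.self_mem_closedNbhd x) (mem_missing.1 hA.1).1), Finset.mem_insert_self _ _⟩
    · rw [Finset.mem_coe, Finset.mem_filter] at hA hB
      rw [← Finset.erase_insert hA.2, hAB, Finset.erase_insert hB.2]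
  omega

/-- Every set between `insert x S` and the block is missing and contains x. There are at most K <
2^l of these, so `insert x S` has codimension below l; dropping x costs at most one more. -/
theorem card_sdiff_le (h : IsDense F d K l) {x : V} (hx : (closedNbhd F x).card = d)
    {S : Finset V} (hS : S ∈ missing F (closedNbhd F x)) : (closedNbhd F x \ S).card ≤ l := by
  have h1 := h.card_missing_filter_le hx
  have hxB := h.self_mem_closedNbhd x
  have h2 : (closedNbhd F x \ insert x S).powerset.card ≤
      ((missing F (closedNbhd F x)).filter (x ∈ ·)).card := by
    refine Finset.card_le_card_of_injOn (· ∪ insert x S) (fun A hA => ?_) fun A hA B hB hAB => ?_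
    · rw [Finset.mem_coe, Finset.mem_powerset] at hA
      rw [Finset.mem_coe, Finset.mem_filter]
      refine ⟨h.missing_up hS ?_ ?_, ?_⟩
      · exact (Finset.subset_insert x S).trans Finset.subset_union_right
      · exact Finset.union_subset (hA.trans Finset.sdiff_subset)
          (Finset.insert_subset hxB (mem_missing.1 hS).1)
      · exact Finset.mem_union_right _ (Finset.mem_insert_self _ _)
    · rw [Finset.mem_coe, Finset.mem_powerset] at hA hB
      have hA' := Finset.union_sdiff_cancel_right (Finset.disjoint_of_subset_left hA
        Finset.sdiff_disjoint)
      have hB' := Finset.union_sdiff_cancel_right (Finset.disjoint_of_subset_left hB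
        Finset.sdiff_disjoint)
      simp only at hAB
      rw [← hA', hAB, hB']
  rw [Finset.card_powerset] at h2
  have h3 := h.lt_pow
  have h4 := h.le_K
  have h5 : (closedNbhd F x \ insert x S).card < l := by
    rw [← Nat.pow_lt_pow_iff_right (a := 2) (by norm_num)]
    omega
  have h6 : closedNbhd F x \ S ⊆ insert x (closedNbhd F x \ insert x S) := fun y hy => by
    simp only [Finset.mem_sdiff, Finset.mem_insert] at hy ⊢
    tauto
  have := (Finset.card_le_card h6).trans (Finset.card_insert_le _ _)
  omega

/-- A pair has codimension at least d - 2 > l in the block, so no pair can be missing. Hence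
distinct blocks have disjoint sets of tight points. -/
theorem subset_closedNbhd_of_mem (h : IsDense F d K l) {x y : V}
    (hx : (closedNbhd F x).card = d) (hy : y ∈ closedNbhd F x) :
    closedNbhd F x ⊆ closedNbhd F y := fun z hz => by
  rw [mem_closedNbhd]
  by_contra hcon
  have h1 := h.card_sdiff_le hx (S := {y, z}) (mem_missing.2
    ⟨Finset.insert_subset hy (Finset.singleton_subset_iff.2 hz), hcon⟩)
  have h2 := Finset.le_card_sdiff {y, z} (closedNbhd F x)
  have h3 := Finset.card_le_two (a := y) (b := z)
  have h4 := h.le_l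
  have h5 := h.one_le_l
  omega

theorem closedNbhd_eq_of_mem (h : IsDense F d K l) {x y : V} (hx : (closedNbhd F x).card = d)
    (hy : (closedNbhd F y).card = d) (hyx : y ∈ closedNbhd F x) :
    closedNbhd F y = closedNbhd F x :=
  (Finset.eq_of_subset_of_card_le (h.subset_closedNbhd_of_mem hx hyx) (by omega)).symm

/-- The link is trimmed to exactly `2 ^ (d - 1) - K` sets while keeping d singletons, one more than
a (d - 1)-dimensional cube has. The gain `f 1` = 1/2 covers the loss (K + 1) / (d - l) - K / d. -/
theorem le_pointWeight_of_lt_card (h : IsDense F d K l) {x : V}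
    (hx : d < (closedNbhd F x).card) : ((2 : ℝ) ^ d - 1 - K) / d ≤ pointWeight F x := by
  obtain ⟨U, hU, hUc⟩ := Finset.exists_subset_card_eq (s := (closedNbhd F x).erase x) (n := d)
    (by rw [Finset.card_erase_of_mem (h.self_mem_closedNbhd x)]; omega)
  have hdeg := h.degree x
  have hsq := h.five_mul_sq_le
  have hK := h.le_K
  have hd := h.le_d
  have hl := h.le_l
  have hpow : 2 ^ (d - 1) = 2 ^ (d - 2) * 2 := by rw [← pow_succ]; congr 1; omega
  have hL := h.lower.memberSubfamily (a := x)
  have hlow : IsLowerSet ((insert ∅ (U.image ({·} : V → Finset V)) : Finset (Finset V)) :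
      Set (Finset V)) := by
    intro A B hBA hA
    rw [Finset.mem_coe, Finset.mem_insert, Finset.mem_image] at hA ⊢
    rcases hA with rfl | ⟨v, hv, rfl⟩
    · exact Or.inl (Finset.subset_empty.1 hBA)
    · rcases Finset.subset_singleton_iff.1 hBA with rfl | rfl
      · exact Or.inl rfl
      · exact Or.inr ⟨v, hv, rfl⟩
  have hsing : ∀ v ∈ U, ({v} : Finset V) ∈ F.memberSubfamily x := fun v hv => by
    have hv' := Finset.mem_erase.1 (hU hv)
    rw [Finset.mem_memberSubfamily, Finset.mem_singleton]
    exact ⟨mem_closedNbhd.1 hv'.2, hv'.1.symm⟩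
  have hsub : insert ∅ (U.image ({·} : V → Finset V)) ⊆ F.memberSubfamily x := by
    refine Finset.insert_subset ?_ fun A hA => ?_
    · rw [Finset.mem_memberSubfamily]
      exact ⟨by simpa using h.singleton_mem x, Finset.notMem_empty _⟩
    · obtain ⟨v, hv, rfl⟩ := Finset.mem_image.1 hA
      exact hsing v hv
  have hle : (insert ∅ (U.image ({·} : V → Finset V))).card ≤ 2 ^ (d - 1) - K := by
    refine (Finset.card_insert_le _ _).trans ?_
    have := Finset.card_image_le (s := U) (f := ({·} : V → Finset V))
    have : d * 50 ≤ d ^ 2 := by nlinarith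
    omega
  obtain ⟨L, hLl, hL1, hL2, hLc⟩ := exists_lower_between hlow hL hsub hle
    (by rw [card_memberSubfamily]; omega)
  have key := initialWeight_add_le_sum antitone_one_div_add_one hLl (V := U) (D := d - 1)
    (fun v hv => hL1 (Finset.mem_insert_of_mem (Finset.mem_image_of_mem _ hv))) (by omega)
    (by omega)
  rw [hLc, Nat.sub_sub] at key
  have h1 := initialWeight_two_pow_sub_ge (d := d) (K := K) (l := l) hK (by omega) h.lt_pow
  have h2 : ∑ A ∈ L, 1 / ((A.card : ℝ) + 1) ≤ pointWeight F x := by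
    rw [pointWeight_eq_sum_link]
    exact Finset.sum_le_sum_of_subset_of_nonneg hL2 fun _ _ _ => by positivity
  have hd' : (50 : ℝ) ≤ d := by exact_mod_cast hd
  have hl' : (7 * l + 2 : ℝ) ≤ d := by exact_mod_cast hl
  have hK' : (K + 2 : ℝ) ≤ d := by exact_mod_cast hK
  have h3 : ((K : ℝ) + 1) / (d - l) ≤ K / d + 1 / 2 := by
    have hK0 : (0 : ℝ) ≤ K := Nat.cast_nonneg _
    rw [div_add_div _ _ (by positivity) (by norm_num), div_le_div_iff₀ (by linarith) (by positivity)]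
    nlinarith [mul_nonneg hK0 (show (0 : ℝ) ≤ d - 7 * l by linarith)]
  have h4 : ((2 : ℝ) ^ d - 1 - K) / d = (2 ^ d - 1) / d - K / d := by ring
  norm_num at key
  norm_num at h1
  norm_num at h2
  rw [h4]
  linarith

end IsDense

end Dense

/-! ### Paying for block deficits with members leaving the block -/

section Dense

variable {V : Type*}

theorem card_le_mul_sum_one_div_card {O O' : Finset (Finset V)} (hO : O' ⊆ O)
    (hne : ∀ A ∈ O', A.Nonempty) {p : ℕ} (hp : ∀ A ∈ O', A.card ≤ p) (hp0 : 0 < p) :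
    (O'.card : ℝ) ≤ (∑ A ∈ O, 1 / (A.card : ℝ)) * p := by
  have h1 : ∀ A ∈ O', 1 / (p : ℝ) ≤ 1 / (A.card : ℝ) := fun A hA => by
    have h2 : (0 : ℝ) < A.card := by exact_mod_cast Finset.card_pos.2 (hne A hA)
    exact one_div_le_one_div_of_le h2 (by exact_mod_cast hp A hA)
  have h3 := Finset.card_nsmul_le_sum _ _ _ h1
  have h4 : ∑ A ∈ O', 1 / (A.card : ℝ) ≤ ∑ A ∈ O, 1 / (A.card : ℝ) :=
    Finset.sum_le_sum_of_subset_of_nonneg hO fun _ _ _ => by positivity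
  have hp' : (0 : ℝ) < p := by exact_mod_cast hp0
  rw [nsmul_eq_mul, mul_one_div] at h3
  exact (div_le_iff₀ hp').1 (h3.trans h4)

variable [DecidableEq V]

/-- The members of `F` containing `y` that are not inside `B`. -/
def outside (F : Finset (Finset V)) (B : Finset V) (y : V) : Finset (Finset V) :=
  F.filter fun A => y ∈ A ∧ ¬ A ⊆ B

theorem pointWeight_eq_inside_add (F : Finset (Finset V)) (B : Finset V) (y : V) :
    pointWeight F y = pointWeight (inside F B) y + ∑ A ∈ outside F B y, 1 / (A.card : ℝ) := by
  rw [pointWeight, ← Finset.sum_filter_add_sum_filter_not _ (· ⊆ B), pointWeight]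
  congr 1
  · refine Finset.sum_congr ?_ fun _ _ => rfl
    ext A
    simp only [mem_inside, Finset.mem_filter]
    tauto
  · refine Finset.sum_congr ?_ fun _ _ => rfl
    ext A
    simp only [outside, Finset.mem_filter]
    tauto

namespace IsDense

variable {F : Finset (Finset V)} {d K l : ℕ}

/-- The degree bound holds at y too, so whatever y lacks inside B beyond K is made up by members
leaving B. -/
theorem missing_sub_le_card_outside (h : IsDense F d K l) {B : Finset V} {y : V} (hyB : y ∈ B)
    (hB : B.card = d) :
    ((missing F B).filter (y ∈ ·)).card ≤ (outside F B y).card + K := by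
  have h1 := card_inside_filter_mem (F := F) hyB
  have h2 := h.degree y
  have h3 : (F.filter (y ∈ ·)).card = ((inside F B).filter (y ∈ ·)).card
      + (outside F B y).card := by
    rw [← Finset.card_filter_add_card_filter_not (s := F.filter (y ∈ ·)) (· ⊆ B)]
    congr 2
    · ext A
      simp only [mem_inside, Finset.mem_filter]
      tauto
    · ext A
      simp only [outside, Finset.mem_filter]
      tauto
  rw [hB] at h1
  omega

theorem pointWeight_inside_le (h : IsDense F d K l) {B : Finset V} {y : V} (hB : B.card = d)
    (hy : y ∈ B) : pointWeight (inside F B) y ≤ ((2 : ℝ) ^ d - 1 - K) / d + 1 := by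
  have h1 := pointWeight_inside (F := F) hy
  have h2 := pointWeight_nonneg (missing F B) y
  rw [hB] at h1
  have hd : (50 : ℝ) ≤ d := by exact_mod_cast h.le_d
  have hK : (K + 2 : ℝ) ≤ d := by exact_mod_cast h.le_K
  have h3 : (K : ℝ) / d ≤ 1 := (div_le_one (by linarith)).2 (by linarith)
  have h4 : ((2 : ℝ) ^ d - 1 - K) / d = (2 ^ d - 1) / d - K / d := by ring
  linarith

variable [Fintype V]

theorem exists_pair_mem_outside {B : Finset V} {y : V}
    (hB : B.card = d) (hy : d < (closedNbhd F y).card) :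
    ∃ z, z ∉ B ∧ ({y, z} : Finset V) ∈ F := by
  by_contra! hcon
  have : closedNbhd F y ⊆ B := fun z hz => by
    by_contra hzB
    exact hcon z hzB (mem_closedNbhd.1 hz)
  have := Finset.card_le_card this
  omega

theorem half_le_sum_outside {B : Finset V} {y : V} (hB : B.card = d) (hy : d < (closedNbhd F y).card) :
    1 / 2 ≤ ∑ A ∈ outside F B y, 1 / (A.card : ℝ) := by
  obtain ⟨z, hz, hyz⟩ := exists_pair_mem_outside hB hy
  have hO : {{y, z}} ⊆ outside F B y := by
    rw [Finset.singleton_subset_iff, outside, Finset.mem_filter]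
    exact ⟨hyz, by simp, fun hsub => hz (hsub (by simp))⟩
  have := card_le_mul_sum_one_div_card hO (p := 2)
    (fun A hA => by rw [Finset.mem_singleton.1 hA]; simp)
    (fun A hA => by rw [Finset.mem_singleton.1 hA]; exact Finset.card_le_two) (by norm_num)
  rw [Finset.card_singleton] at this
  push_cast at this
  linarith

/-- If all outside members have at most l + 2 points, counting them suffices. Otherwise the subsets
of one large member that contain y and a fixed point z outside the block supply 2^l members of size
at most l + 2, while the excess is at most K < 2^l. -/
theorem missing_sub_le_sum_outside (h : IsDense F d K l) {x y : V}
    (hx : (closedNbhd F x).card = d) (hyB : y ∈ closedNbhd F x) :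
    (((missing F (closedNbhd F x)).filter (y ∈ ·)).card : ℝ) - K ≤
      (∑ A ∈ outside F (closedNbhd F x) y, 1 / (A.card : ℝ)) * (l + 2) := by
  set B := closedNbhd F x
  have h1 := h.missing_sub_le_card_outside hyB hx
  have hne : ∀ A ∈ outside F B y, A.Nonempty := fun A hA =>
    ⟨y, (Finset.mem_filter.1 hA).2.1⟩
  by_cases hall : ∀ A ∈ outside F B y, A.card ≤ l + 2
  · have h2 := card_le_mul_sum_one_div_card subset_rfl hne hall (by omega)
    have h3 : (((missing F B).filter (y ∈ ·)).card : ℝ) ≤ (outside F B y).card + K := by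
      exact_mod_cast h1
    push_cast at h2
    linarith
  · push Not at hall
    obtain ⟨A, hA, hAc⟩ := hall
    rw [outside, Finset.mem_filter] at hA
    obtain ⟨hAF, hyA, hAB⟩ := hA
    obtain ⟨z, hzA, hzB⟩ := Finset.not_subset.1 hAB
    have hyz : y ≠ z := fun e => hzB (e ▸ hyB)
    obtain ⟨C, hC1, hC2, hC3⟩ := Finset.exists_subsuperset_card_eq (s := {y, z}) (t := A)
      (n := l + 2) (Finset.insert_subset hyA (Finset.singleton_subset_iff.2 hzA))
      (by rw [Finset.card_pair hyz]; omega) hAc.le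
    have hO : Finset.Icc {y, z} C ⊆ outside F B y := fun S hS => by
      rw [Finset.mem_Icc] at hS
      rw [outside, Finset.mem_filter]
      exact ⟨h.lower (hS.2.trans hC2) hAF, hS.1 (by simp), fun hSB => hzB (hSB (hS.1 (by simp)))⟩
    have h2 := card_le_mul_sum_one_div_card hO (fun S hS => hne S (hO hS)) (p := l + 2)
      (fun S hS => (Finset.card_le_card (Finset.mem_Icc.1 hS).2).trans hC3.le) (by omega)
    rw [Finset.card_Icc_finset hC1, hC3, Finset.card_pair hyz, Nat.add_sub_cancel] at h2
    push_cast at h2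
    refine le_trans ?_ h2
    have h3 : ((missing F B).filter (y ∈ ·)).card ≤ 2 ^ l + K := by
      refine (Finset.card_filter_le _ _).trans ((h.card_missing_le hx).trans ?_)
      have := h.lt_pow
      have := h.le_K
      omega
    have h4 : (((missing F B).filter (y ∈ ·)).card : ℝ) ≤ 2 ^ l + K := by exact_mod_cast h3
    linarith

theorem le_pointWeight_inside (h : IsDense F d K l) {x y : V}
    (hx : (closedNbhd F x).card = d) (hy : y ∈ closedNbhd F x) :
    ((2 : ℝ) ^ d - 1 - K) / d - 2 * K ≤ pointWeight (inside F (closedNbhd F x)) y := by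
  have h1 := pointWeight_inside (F := F) hy
  have h2 := pointWeight_le_card (missing F (closedNbhd F x)) y
  rw [hx] at h1
  have h3 : (((missing F (closedNbhd F x)).filter (y ∈ ·)).card : ℝ) ≤ 2 * K := by
    exact_mod_cast (Finset.card_filter_le _ _).trans (h.card_missing_le hx)
  have h4 : ((2 : ℝ) ^ d - 1 - K) / d = (2 ^ d - 1) / d - K / d := by ring
  have h5 : (0 : ℝ) ≤ K / d := by positivity
  linarith

/-- The closed neighbourhoods of smallest possible size. -/
def blocks (F : Finset (Finset V)) (d : ℕ) : Finset (Finset V) :=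
  (Finset.univ.filter fun x => (closedNbhd F x).card = d).image (closedNbhd F)

theorem mem_blocks {B : Finset V} :
    B ∈ blocks F d ↔ ∃ x, (closedNbhd F x).card = d ∧ closedNbhd F x = B := by
  simp [blocks]

theorem le_card_filter_pair (h : IsDense F d K l) {x y : V} (hx : (closedNbhd F x).card = d)
    (hy : y ∈ closedNbhd F x) :
    2 ^ (d - 2) ≤ (F.filter fun A => y ∈ A ∧ x ∈ A).card + K := by
  set B := closedNbhd F x
  have hpair : ({x, y} : Finset V) ⊆ B :=
    Finset.insert_subset (h.self_mem_closedNbhd x) (Finset.singleton_subset_iff.2 hy)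
  have h1 : 2 ^ (d - 2) ≤ (Finset.Icc {x, y} B).card := by
    rw [Finset.card_Icc_finset hpair, hx]
    refine Nat.pow_le_pow_right (by norm_num) ?_
    have := Finset.card_le_two (a := x) (b := y)
    omega
  have h2 : Finset.Icc {x, y} B ⊆
      (F.filter fun A => y ∈ A ∧ x ∈ A) ∪ (missing F B).filter (x ∈ ·) := fun A hA => by
    rw [Finset.mem_Icc] at hA
    have hxA : x ∈ A := hA.1 (by simp)
    have hyA : y ∈ A := hA.1 (by simp)
    rw [Finset.mem_union, Finset.mem_filter, Finset.mem_filter, mem_missing]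
    by_cases hAF : A ∈ F
    · exact Or.inl ⟨hAF, hyA, hxA⟩
    · exact Or.inr ⟨⟨hA.2, hAF⟩, hxA⟩
  have h3 := (Finset.card_le_card h2).trans (Finset.card_union_le _ _)
  have h4 : ((missing F B).filter (x ∈ ·)).card ≤ K := h.card_missing_filter_le hx
  omega

theorem le_sum_of_two_le_card (h : IsDense F d K l) {y : V}
    (hy : 2 ≤ ((blocks F d).filter (y ∈ ·)).card) :
    (((blocks F d).filter (y ∈ ·)).card : ℝ) * d ≤
      pointWeight F y - ((2 : ℝ) ^ d - 1 - K) / d +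
      ∑ B ∈ (blocks F d).filter (y ∈ ·),
        (((2 : ℝ) ^ d - 1 - K) / d - pointWeight (inside F B) y) := by
  set Y := (blocks F d).filter (y ∈ ·) with hY
  have hx : ∀ B : Y, ∃ x, (closedNbhd F x).card = d ∧ closedNbhd F x = B.1 := fun B =>
    mem_blocks.1 (Finset.mem_filter.1 B.2).1
  have hyY : ∀ B ∈ Y, y ∈ B := fun B hB => (Finset.mem_filter.1 hB).2
  choose g hg1 hg2 using hx
  -- Members through y and a chosen tight point of B lie in B and in no other block at y. Seen from
  -- a fixed block `B₀`, those of the other blocks are disjoint families of outside members.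
  let Q : Finset V → Finset (Finset V) := fun B =>
    if hB : B ∈ Y then F.filter fun A => y ∈ A ∧ g ⟨B, hB⟩ ∈ A else ∅
  have hQ : ∀ B ∈ Y, ∀ A ∈ Q B, A ∈ F ∧ y ∈ A ∧ A ⊆ B ∧ ∀ B' ∈ Y, A ⊆ B' → B' = B := by
    intro B hB A hA
    simp only [Q, hB, dite_true, Finset.mem_filter] at hA
    obtain ⟨hAF, hyA, hgA⟩ := hA
    refine ⟨hAF, hyA, ?_, fun B' hB' hAB' => ?_⟩
    · have := h.subset_closedNbhd hAF hgA
      rwa [hg2] at this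
    · have h1 := hAB' hgA
      have e1 := hg2 ⟨B, hB⟩
      have e2 := hg2 ⟨B', hB'⟩
      simp only at e1 e2
      rw [← e2] at h1
      have := h.closedNbhd_eq_of_mem (hg1 _) (hg1 _) h1
      rw [e1, e2] at this
      exact this.symm
  have hd : (50 : ℝ) ≤ d := by exact_mod_cast h.le_d
  have hK : (K + 2 : ℝ) ≤ d := by exact_mod_cast h.le_K
  have hK0 : (0 : ℝ) ≤ K := Nat.cast_nonneg _
  have hsq : (5 * d ^ 2 : ℝ) ≤ 2 ^ (d - 2) := by exact_mod_cast h.five_mul_sq_le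
  have hq : ∀ B ∈ Y, ((2 : ℝ) ^ (d - 2) - K) / d ≤ ∑ A ∈ Q B, 1 / (A.card : ℝ) := by
    intro B hB
    have hyB : y ∈ closedNbhd F (g ⟨B, hB⟩) := by rw [hg2]; exact hyY B hB
    have h1 := h.le_card_filter_pair (hg1 ⟨B, hB⟩) hyB
    have h2 := card_le_mul_sum_one_div_card (subset_refl (Q B)) (p := d)
      (fun A hA => ⟨y, (hQ B hB A hA).2.1⟩)
      (fun A hA => by
        have := Finset.card_le_card (hQ B hB A hA).2.2.1
        have e := hg1 ⟨B, hB⟩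
        rw [hg2] at e
        simp only at e
        omega) (by have := h.le_d; omega)
    have h3 : (Q B).card = (F.filter fun A => y ∈ A ∧ g ⟨B, hB⟩ ∈ A).card := by
      simp only [Q, hB, dite_true]
    rw [div_le_iff₀ (by linarith)]
    refine le_trans ?_ h2
    rw [h3]
    have h4 : (2 : ℝ) ^ (d - 2) ≤ (F.filter fun A => y ∈ A ∧ g ⟨B, hB⟩ ∈ A).card + K := by
      exact_mod_cast h1
    linarith
  obtain ⟨B₀, hB₀⟩ := Finset.card_pos.1 (show 0 < Y.card by omega)
  obtain ⟨x₀, hx₀, hxB₀⟩ := mem_blocks.1 (Finset.mem_filter.1 hB₀).1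
  have hin := h.le_pointWeight_inside hx₀ (y := y) (hxB₀ ▸ hyY B₀ hB₀)
  rw [hxB₀] at hin
  have hout : ∑ B ∈ Y.erase B₀, ∑ A ∈ Q B, 1 / (A.card : ℝ) ≤
      ∑ A ∈ outside F B₀ y, 1 / (A.card : ℝ) := by
    rw [← Finset.sum_biUnion]
    · refine Finset.sum_le_sum_of_subset_of_nonneg (fun A hA => ?_) fun _ _ _ => by positivity
      obtain ⟨B, hB, hAB⟩ := Finset.mem_biUnion.1 hA
      have hB' := Finset.mem_erase.1 hB
      have := hQ B hB'.2 A hAB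
      rw [outside, Finset.mem_filter]
      exact ⟨this.1, this.2.1, fun hA0 => hB'.1 (this.2.2.2 B₀ hB₀ hA0).symm⟩
    · intro B hB B' hB' hne
      rw [Function.onFun, Finset.disjoint_left]
      intro A hA hA'
      have hB := (Finset.mem_erase.1 hB).2
      have hB' := (Finset.mem_erase.1 hB').2
      exact hne ((hQ B' hB' A hA').2.2.2 B hB (hQ B hB A hA).2.2.1)
  have hlow := Finset.card_nsmul_le_sum (Y.erase B₀) (fun B => ∑ A ∈ Q B, 1 / (A.card : ℝ)) _
    fun B hB => hq B (Finset.mem_erase.1 hB).2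
  have hsum := Finset.card_nsmul_le_sum Y
    (fun B => ((2 : ℝ) ^ d - 1 - K) / d - pointWeight (inside F B) y) (-1) fun B hB => by
      obtain ⟨x, hx, hxB⟩ := mem_blocks.1 (Finset.mem_filter.1 hB).1
      have := h.pointWeight_inside_le (hxB ▸ hx) (hyY B hB)
      linarith
  have hj : ((Y.erase B₀).card : ℝ) = Y.card - 1 := by
    rw [Finset.card_erase_of_mem hB₀, Nat.cast_sub (by omega), Nat.cast_one]
  have hj2 : (2 : ℝ) ≤ Y.card := by exact_mod_cast hy
  rw [nsmul_eq_mul, hj] at hlow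
  rw [nsmul_eq_mul] at hsum
  rw [pointWeight_eq_inside_add F B₀ y]
  have hqd : (4 * d : ℝ) ≤ ((2 : ℝ) ^ (d - 2) - K) / d := by
    rw [le_div_iff₀ (by linarith)]
    nlinarith
  have hqd' : ((Y.card : ℝ) - 1) * (((2 : ℝ) ^ (d - 2) - K) / d) ≥ (Y.card - 1) * (4 * d + 2) := by
    refine mul_le_mul_of_nonneg_left ?_ (by linarith)
    rw [le_div_iff₀ (by linarith)]
    nlinarith
  nlinarith

/-- What a point `y` of a block `B` outside of the tight set contributes to `B`. -/
noncomputable def share (F : Finset (Finset V)) (d : ℕ) (B : Finset V) (y : V) : ℝ :=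
  if ((blocks F d).filter (y ∈ ·)).card = 1 then ∑ A ∈ outside F B y, 1 / (A.card : ℝ) else d

/-- The points of minimum closed neighbourhood. -/
def tight (F : Finset (Finset V)) (d : ℕ) : Finset V :=
  Finset.univ.filter fun x => (closedNbhd F x).card = d

theorem mem_tight {x : V} : x ∈ tight F d ↔ (closedNbhd F x).card = d := by
  simp [tight]

theorem lt_card_of_notMem_tight (h : IsDense F d K l) {y : V} (hy : y ∉ tight F d) :
    d < (closedNbhd F y).card :=
  lt_of_le_of_ne (h.le_card_closedNbhd y) fun e => hy (mem_tight.2 e.symm)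

theorem card_missing_sub_le_sum_share (h : IsDense F d K l) {B : Finset V}
    (hB : B ∈ blocks F d) :
    ((missing F B).card : ℝ) - K ≤ ∑ y ∈ B \ tight F d, share F d B y := by
  obtain ⟨x, hx, rfl⟩ := mem_blocks.1 hB
  set B := closedNbhd F x
  have hd : (50 : ℝ) ≤ d := by exact_mod_cast h.le_d
  have hK : (K + 2 : ℝ) ≤ d := by exact_mod_cast h.le_K
  have hsd : B \ tight F d = B \ (B ∩ tight F d) := (Finset.sdiff_inter_self_left _ _).symm
  rw [hsd]
  refine card_sub_le_sum_of_degree_le (l := l) Finset.inter_subset_left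
    (fun S hS => (mem_missing.1 hS).1) (fun S hS S' hSS' hS' => h.missing_up hS hSS' hS')
    (hx.symm ▸ h.le_K) (fun z hz => ?_) (fun S hS => h.card_sdiff_le hx hS) h.one_le_l
    (hx.symm ▸ h.le_l) (fun y hy => ?_) (fun y hy => ?_)
  · rw [Finset.mem_inter, mem_tight] at hz
    have h1 := h.card_missing_filter_le hz.2
    rwa [h.closedNbhd_eq_of_mem hx hz.2 hz.1] at h1
  · rw [← hsd, Finset.mem_sdiff] at hy
    rw [share]
    split_ifs
    · exact half_le_sum_outside hx (h.lt_card_of_notMem_tight hy.2)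
    · linarith
  · rw [← hsd, Finset.mem_sdiff] at hy
    rw [share]
    split_ifs
    · exact h.missing_sub_le_sum_outside hx hy.1
    -- For a point in several blocks the flat share d suffices, since the excess is at most K < d.
    · have h3 : (((missing F B).filter (y ∈ ·)).card : ℝ) ≤ 2 * K := by
        exact_mod_cast (Finset.card_filter_le _ _).trans (h.card_missing_le hx)
      have hl0 : (0 : ℝ) ≤ l := Nat.cast_nonneg _
      nlinarith

/-- Split by the number of blocks through y: with none this is the sharpened Katona bound, with one
it is an identity, and with more the outside weight is ample. -/
theorem sum_share_le (h : IsDense F d K l) {y : V} (hy : y ∉ tight F d) :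
    ∑ B ∈ (blocks F d).filter (y ∈ ·), share F d B y ≤
      pointWeight F y - ((2 : ℝ) ^ d - 1 - K) / d +
      ∑ B ∈ (blocks F d).filter (y ∈ ·),
        (((2 : ℝ) ^ d - 1 - K) / d - pointWeight (inside F B) y) := by
  set Y := (blocks F d).filter (y ∈ ·) with hY
  rcases Nat.lt_trichotomy Y.card 1 with h0 | h1 | h2
  · have : Y = ∅ := Finset.card_eq_zero.1 (by omega)
    rw [this, Finset.sum_empty, Finset.sum_empty]
    linarith [h.le_pointWeight_of_lt_card (h.lt_card_of_notMem_tight hy)]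
  · obtain ⟨B, hYB⟩ := Finset.card_eq_one.1 h1
    rw [hYB, Finset.sum_singleton, Finset.sum_singleton, share, if_pos (hY ▸ h1),
      pointWeight_eq_inside_add F B y]
    linarith
  · have h3 : ∀ B ∈ Y, share F d B y = d := fun B _ => by
      rw [share, if_neg (by rw [← hY]; omega)]
    rw [Finset.sum_congr rfl h3, Finset.sum_const, nsmul_eq_mul]
    exact h.le_sum_of_two_le_card h2

/-- The lower bound for the size of a dense lower family. -/
theorem card_mul_le (h : IsDense F d K l) :
    (Fintype.card V : ℝ) * (((2 : ℝ) ^ d - 1 - K) / d) ≤ (F.erase ∅).card := by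
  set τ := ((2 : ℝ) ^ d - 1 - K) / d with hτ
  have hd : (50 : ℝ) ≤ d := by exact_mod_cast h.le_d
  rw [← sum_pointWeight fun A _ => Finset.subset_univ A]
  -- All members at a tight point of B lie inside B, and the inside weights over B total 2^d - 1 -
  -- |missing| = dτ + K - |missing|.
  have hblock : ∀ B ∈ blocks F d,
      ∑ x ∈ (tight F d).filter (closedNbhd F · = B), (pointWeight F x - τ) =
      K - (missing F B).card + ∑ y ∈ B \ tight F d, (τ - pointWeight (inside F B) y) := by
    intro B hB
    obtain ⟨x, hx, hxB⟩ := mem_blocks.1 hB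
    have hBd : B.card = d := hxB ▸ hx
    have hT : (tight F d).filter (closedNbhd F · = B) = B ∩ tight F d := by
      ext z
      rw [Finset.mem_filter, Finset.mem_inter, mem_tight]
      constructor
      · rintro ⟨hz, rfl⟩
        exact ⟨h.self_mem_closedNbhd z, hz⟩
      · rintro ⟨hz, hzd⟩
        rw [← hxB] at hz ⊢
        exact ⟨hzd, h.closedNbhd_eq_of_mem hx hzd hz⟩
    have hw : ∀ z ∈ B ∩ tight F d, pointWeight F z - τ = pointWeight (inside F B) z - τ := by
      intro z hz
      rw [← hT, Finset.mem_filter] at hz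
      rw [pointWeight_eq_inside_add F B z, Finset.sum_eq_zero, add_zero]
      intro A hA
      rw [outside, Finset.mem_filter] at hA
      exact absurd (hz.2 ▸ h.subset_closedNbhd hA.1 hA.2.1) hA.2.2
    have htot := sum_pointWeight (G := inside F B) (B := B) fun A hA => (mem_inside.1 hA).2
    have hempty : ∅ ∈ inside F B := mem_inside.2
      ⟨h.lower (Finset.empty_subset {x}) (h.singleton_mem x), Finset.empty_subset B⟩
    have hc := card_inside_add_card_missing F B
    have hc' := Finset.card_erase_add_one hempty
    have hcR : (((inside F B).erase ∅).card : ℝ) + 1 + (missing F B).card = 2 ^ d := by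
      rw [← hBd]
      exact_mod_cast hc'.symm ▸ hc
    rw [hT, Finset.sum_congr rfl hw]
    have hsplit := Finset.sum_inter_add_sum_sdiff B (tight F d)
      fun z => pointWeight (inside F B) z - τ
    have hneg : ∑ y ∈ B \ tight F d, (τ - pointWeight (inside F B) y) =
        - ∑ y ∈ B \ tight F d, (pointWeight (inside F B) y - τ) := by
      rw [← Finset.sum_neg_distrib]
      exact Finset.sum_congr rfl fun _ _ => by ring
    have hall : ∑ z ∈ B, (pointWeight (inside F B) z - τ) = K - (missing F B).card := by
      rw [Finset.sum_sub_distrib, htot, Finset.sum_const, nsmul_eq_mul, hBd, hτ,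
        mul_div_cancel₀ _ (by linarith)]
      linarith
    rw [hneg]
    linarith
  have hswap : ∀ g : Finset V → V → ℝ, ∑ B ∈ blocks F d, ∑ y ∈ B \ tight F d, g B y =
      ∑ y ∈ (tight F d)ᶜ, ∑ B ∈ (blocks F d).filter (y ∈ ·), g B y := fun g => by
    refine Finset.sum_comm' fun B y => ?_
    rw [Finset.mem_sdiff, Finset.mem_filter, Finset.mem_compl]
    tauto
  have htight : ∑ x ∈ tight F d, (pointWeight F x - τ) =
      ∑ B ∈ blocks F d, ∑ x ∈ (tight F d).filter (closedNbhd F · = B), (pointWeight F x - τ) :=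
    (Finset.sum_fiberwise_of_maps_to (fun x hx => mem_blocks.2 ⟨x, mem_tight.1 hx, rfl⟩) _).symm
  have hcompl : ∑ y ∈ (tight F d)ᶜ, ∑ B ∈ (blocks F d).filter (y ∈ ·), share F d B y ≤
      ∑ y ∈ (tight F d)ᶜ, (pointWeight F y - τ + ∑ B ∈ (blocks F d).filter (y ∈ ·),
        (τ - pointWeight (inside F B) y)) :=
    Finset.sum_le_sum fun y hy => h.sum_share_le (Finset.mem_compl.1 hy)
  have hshare := Finset.sum_le_sum fun B hB => h.card_missing_sub_le_sum_share (B := B) hB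
  have hsum := Finset.sum_add_sum_compl (tight F d) fun x => pointWeight F x - τ
  rw [Finset.sum_sub_distrib (s := Finset.univ), Finset.sum_const, nsmul_eq_mul,
    Finset.card_univ] at hsum
  rw [Finset.sum_congr rfl hblock, Finset.sum_add_distrib, hswap] at htight
  rw [hswap] at hshare
  rw [Finset.sum_add_distrib] at hcompl
  rw [Finset.sum_sub_distrib (s := blocks F d)] at htight hshare
  linarith

end IsDense

end Dense

/-! ### Reduction to lower families -/

section Compression

variable {V : Type*} [DecidableEq V]

theorem isLowerSet_of_erase_mem {F : Finset (Finset V)} (h : ∀ A ∈ F, ∀ a ∈ A, A.erase a ∈ F) :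
    IsLowerSet (F : Set (Finset V)) := by
  intro A B hBA hA
  rw [Finset.mem_coe] at hA ⊢
  induction hn : (A \ B).card generalizing A with
  | zero =>
    rw [Finset.card_eq_zero, Finset.sdiff_eq_empty_iff_subset] at hn
    rwa [Finset.Subset.antisymm hBA hn]
  | succ n ih =>
    obtain ⟨a, ha⟩ := Finset.card_pos.1 (show 0 < (A \ B).card by omega)
    have ha' := Finset.mem_sdiff.1 ha
    refine ih (A := A.erase a) (Finset.subset_erase.2 ⟨hBA, ha'.2⟩) (h A hA a ha'.1) ?_
    rw [Finset.erase_sdiff_comm, Finset.card_erase_of_mem ha, hn, Nat.add_sub_cancel]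

/-- If a lies in T, traces of the compression lie in the compression of the traces, which has the
same size. If not, compressing creates no new trace. -/
theorem card_trace_compression_le (a : V) (F : Finset (Finset V)) (T : Finset V) :
    ((Down.compression a F).image (· ∩ T)).card ≤ (F.image (· ∩ T)).card := by
  by_cases haT : a ∈ T
  · rw [← Down.card_compression a (F.image (· ∩ T))]
    refine Finset.card_le_card fun B hB => ?_
    obtain ⟨A, hA, rfl⟩ := Finset.mem_image.1 hB
    have himg : ∀ A ∈ F, A ∩ T ∈ F.image (· ∩ T) := fun A hA => Finset.mem_image_of_mem _ hA
    rw [Down.mem_compression] at hA ⊢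
    rcases hA with ⟨h1, h2⟩ | ⟨h1, h2⟩
    · refine Or.inl ⟨himg A h1, ?_⟩
      rw [← Finset.erase_inter]
      exact himg _ h2
    · have h3 := himg _ h2
      rw [Finset.insert_inter_of_mem haT] at h3
      have haA : a ∉ A := fun h => h1 (by rwa [Finset.insert_eq_of_mem h] at h2)
      by_cases h4 : A ∩ T ∈ F.image (· ∩ T)
      · refine Or.inl ⟨h4, ?_⟩
        rwa [Finset.erase_eq_of_notMem fun h => haA (Finset.mem_inter.1 h).1]
      · exact Or.inr ⟨h4, h3⟩
  · refine Finset.card_le_card fun B hB => ?_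
    obtain ⟨A, hA, rfl⟩ := Finset.mem_image.1 hB
    rw [Down.mem_compression] at hA
    rcases hA with ⟨h1, -⟩ | ⟨-, h2⟩
    · exact Finset.mem_image_of_mem _ h1
    · exact Finset.mem_image.2 ⟨_, h2, Finset.insert_inter_of_notMem haT⟩

theorem sum_card_compression_lt {a : V} {F : Finset (Finset V)} {A : Finset V} (hA : A ∈ F)
    (hAe : A.erase a ∉ F) :
    ∑ B ∈ Down.compression a F, B.card < ∑ B ∈ F, B.card := by
  rw [Down.compression, Finset.sum_disjUnion, Finset.filter_image,
    ← Finset.sum_filter_add_sum_filter_not F (fun s => s.erase a ∈ F)]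
  refine Nat.add_lt_add_left ?_ _
  have hmem : ∀ s ∈ F.filter (fun s => s.erase a ∉ F), a ∈ s := fun s hs => by
    rw [Finset.mem_filter] at hs
    by_contra has
    exact hs.2 (by rw [Finset.erase_eq_of_notMem has]; exact hs.1)
  rw [Finset.sum_image fun s hs t ht => Finset.erase_injOn' a (hmem s hs) (hmem t ht)]
  exact Finset.sum_lt_sum_of_nonempty ⟨A, Finset.mem_filter.2 ⟨hA, hAe⟩⟩ fun s hs =>
    Finset.card_erase_lt_of_mem (hmem s hs)

/-- Every family can be replaced by a lower one of the same size with no larger traces. -/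
theorem exists_lower_trace_le (F : Finset (Finset V)) :
    ∃ G : Finset (Finset V), IsLowerSet (G : Set (Finset V)) ∧ G.card = F.card ∧
      ∀ T : Finset V, (G.image (· ∩ T)).card ≤ (F.image (· ∩ T)).card := by
  induction hn : ∑ B ∈ F, B.card using Nat.strong_induction_on generalizing F with
  | _ n ih =>
    by_cases h : ∀ A ∈ F, ∀ a ∈ A, A.erase a ∈ F
    · exact ⟨F, isLowerSet_of_erase_mem h, rfl, fun _ => le_rfl⟩
    · push Not at h
      obtain ⟨A, hA, a, -, hAe⟩ := h
      obtain ⟨G, hG, hc, hT⟩ := ih _ (hn ▸ sum_card_compression_lt hA hAe) _ rfl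
      exact ⟨G, hG, hc.trans (Down.card_compression a F),
        fun T => (hT T).trans (card_trace_compression_le a F T)⟩

/-- A member of G at x shares its trace with its erasure, also in G, so it can be discarded.
Allowing F to exceed G serves the padding of a lower family to a prescribed size. -/
theorem card_trace_erase_add_le [Fintype V] {F G : Finset (Finset V)} (hG : G ⊆ F) (x : V)
    (h : ∀ A ∈ G, x ∈ A → A.erase x ∈ G) :
    (F.image (· ∩ Finset.univ.erase x)).card + (G.filter (x ∈ ·)).card ≤ F.card := by
  have hsub : F.image (· ∩ Finset.univ.erase x) ⊆
      (F \ G.filter (x ∈ ·)).image (· ∩ Finset.univ.erase x) := fun B hB => by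
    obtain ⟨A, hA, rfl⟩ := Finset.mem_image.1 hB
    rw [Finset.mem_image]
    by_cases hAG : A ∈ G.filter (x ∈ ·)
    · rw [Finset.mem_filter] at hAG
      refine ⟨A.erase x, ?_, ?_⟩
      · simp [hG (h A hAG.1 hAG.2)]
      · simp
    · exact ⟨A, Finset.mem_sdiff.2 ⟨hA, hAG⟩, rfl⟩
  have h1 := (Finset.card_le_card hsub).trans Finset.card_image_le
  have h2 := Finset.card_sdiff_add_card_eq_card ((Finset.filter_subset (x ∈ ·) G).trans hG)
  omega

theorem le_card_trace_erase_add [Fintype V] {F : Finset (Finset V)} (x : V) :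
    F.card ≤ (F.image (· ∩ Finset.univ.erase x)).card + (F.filter (x ∈ ·)).card := by
  rw [← Finset.card_filter_add_card_filter_not (x ∈ ·), add_comm]
  refine Nat.add_le_add_right (Finset.card_le_card fun A hA => ?_) _
  rw [Finset.mem_filter] at hA
  refine Finset.mem_image.2 ⟨A, hA.1, ?_⟩
  simp [Finset.inter_erase, Finset.erase_eq_of_notMem hA.2]

/-- There is a lower family on `V` with at most `j` nonempty members all of whose degrees
exceed `s`. -/
def HasLower (V : Type*) [DecidableEq V] (s j : ℕ) : Prop :=
  ∃ F : Finset (Finset V), IsLowerSet (F : Set (Finset V)) ∧ F.card ≤ j + 1 ∧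
    ∀ x, s + 1 ≤ (F.filter (x ∈ ·)).card

end Compression

theorem exists_eq_univ_erase {n : ℕ} (hn : 1 ≤ n) {T : Finset (Fin n)} (hT : T.card = n - 1) :
    ∃ x, T = Finset.univ.erase x := by
  have h : Tᶜ.card = 1 := by rw [Finset.card_compl, Fintype.card_fin, hT]; omega
  obtain ⟨x, hx⟩ := Finset.card_eq_one.1 h
  refine ⟨x, ?_⟩
  rw [← compl_compl T, hx]
  ext y
  simp

theorem maxArrow_le_of_hasLower {n s j : ℕ} (hn : 1 ≤ n) (h : HasLower (Fin n) s j) :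
    maxArrow n s ≤ j := by
  by_contra! hlt
  obtain ⟨G, hG, hc, hdeg⟩ := h
  obtain ⟨hle, harr⟩ := (isGreatest_maxArrow n s).1
  obtain ⟨F, hGF, -, hF⟩ := Finset.exists_subsuperset_card_eq (Finset.subset_univ G)
    (n := maxArrow n s) (by omega) (by simpa using hle)
  obtain ⟨T, hT, htr⟩ := harr F hF.ge
  obtain ⟨x, rfl⟩ := exists_eq_univ_erase hn hT
  have h1 := card_trace_erase_add_le hGF x fun A hA _ => hG (Finset.erase_subset x A) hA
  have h2 := hdeg x
  rw [traceOn] at htr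
  omega

/-- By maximality some family violates the next relation. Trimmed to exactly one set more than the
maximum and compressed, it has all degrees above s, since deleting x loses at most the degree of x.
-/
theorem hasLower_maxArrow {n s : ℕ} (hlt : maxArrow n s < 2 ^ n) :
    HasLower (Fin n) s (maxArrow n s) := by
  have hnot : ¬ Arrows n (maxArrow n s + 1) (n - 1) (maxArrow n s + 1 - s) := fun h => by
    have := (isGreatest_maxArrow n s).2 (show maxArrow n s + 1 ∈ arrowSizes n s from ⟨hlt, h⟩)
    omega
  rw [Arrows] at hnot
  push Not at hnot
  obtain ⟨F₀, hF₀, htr⟩ := hnot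
  obtain ⟨F, hFF₀, hF⟩ := Finset.exists_subset_card_eq hF₀
  obtain ⟨G, hG, hGc, hGT⟩ := exists_lower_trace_le F
  refine ⟨G, hG, (hGc.trans hF).le, fun x => ?_⟩
  have h1 := htr (Finset.univ.erase x) (by simp)
  have h2 := hGT (Finset.univ.erase x)
  have h3 := Finset.card_le_card (Finset.image_subset_image
    (f := fun A => A ∩ Finset.univ.erase x) hFF₀)
  have h4 := le_card_trace_erase_add (F := G) x
  rw [traceOn] at h1
  omega

/-! ### Gluing lower families -/

section Transport

variable {V W : Type*} [DecidableEq W]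

theorem isLowerSet_image_map {F : Finset (Finset V)} (hF : IsLowerSet (F : Set (Finset V)))
    (e : V ↪ W) : IsLowerSet ((F.image (Finset.map e) : Finset (Finset W)) : Set (Finset W)) := by
  intro A B hBA hA
  rw [Finset.mem_coe, Finset.mem_image] at hA ⊢
  obtain ⟨A, hA, rfl⟩ := hA
  obtain ⟨B, hB, rfl⟩ := Finset.subset_map_iff.1 hBA
  exact ⟨B, hF hB hA, rfl⟩

theorem card_union_image_map_le {V' : Type*} {F : Finset (Finset V)}
    {F' : Finset (Finset V')} (hF : IsLowerSet (F : Set (Finset V)))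
    (hF' : IsLowerSet (F' : Set (Finset V'))) (e : V ↪ W) (e' : V' ↪ W) {j j' : ℕ}
    (hj : F.card ≤ j + 1) (hj' : F'.card ≤ j' + 1) :
    (F.image (Finset.map e) ∪ F'.image (Finset.map e')).card ≤ j + j' + 1 := by
  have h1 := Finset.card_union_add_card_inter (F.image (Finset.map e)) (F'.image (Finset.map e'))
  have h2 := Finset.card_image_le (s := F) (f := Finset.map e)
  have h3 := Finset.card_image_le (s := F') (f := Finset.map e')
  rcases F.eq_empty_or_nonempty with rfl | ⟨A, hA⟩
  · simp at h1 h2 ⊢; omega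
  rcases F'.eq_empty_or_nonempty with rfl | ⟨A', hA'⟩
  · simp at h1 h3 ⊢; omega
  have h4 : 0 < (F.image (Finset.map e) ∩ F'.image (Finset.map e')).card := by
    refine Finset.card_pos.2 ⟨∅, Finset.mem_inter.2 ⟨?_, ?_⟩⟩
    · exact Finset.mem_image.2 ⟨∅, hF (Finset.empty_subset A) hA, Finset.map_empty e⟩
    · exact Finset.mem_image.2 ⟨∅, hF' (Finset.empty_subset A') hA', Finset.map_empty e'⟩
  omega

variable [DecidableEq V]

theorem degree_le_degree_image_map (F : Finset (Finset V)) (e : V ↪ W) (x : V) :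
    (F.filter (x ∈ ·)).card ≤ ((F.image (Finset.map e)).filter (e x ∈ ·)).card := by
  refine Finset.card_le_card_of_injOn (Finset.map e) (fun A hA => ?_)
    (Finset.map_injective e).injOn
  rw [Finset.mem_coe, Finset.mem_filter] at hA ⊢
  exact ⟨Finset.mem_image_of_mem _ hA.1, Finset.mem_map_of_mem e hA.2⟩

theorem HasLower.union {V' : Type*} [DecidableEq V'] {s j j' : ℕ} (h : HasLower V s j)
    (h' : HasLower V' s j') (e : V ↪ W) (e' : V' ↪ W)
    (hcov : ∀ w, (∃ v, e v = w) ∨ ∃ v, e' v = w) : HasLower W s (j + j') := by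
  obtain ⟨F, hF, hc, hdeg⟩ := h
  obtain ⟨F', hF', hc', hdeg'⟩ := h'
  refine ⟨F.image (Finset.map e) ∪ F'.image (Finset.map e'), ?_,
    card_union_image_map_le hF hF' e e' hc hc', fun w => ?_⟩
  · rw [Finset.coe_union]
    exact (isLowerSet_image_map hF e).union (isLowerSet_image_map hF' e')
  · rcases hcov w with ⟨v, rfl⟩ | ⟨v, rfl⟩
    · exact ((hdeg v).trans (degree_le_degree_image_map F e v)).trans
        (Finset.card_le_card (Finset.filter_subset_filter _ Finset.subset_union_left))
    · exact ((hdeg' v).trans (degree_le_degree_image_map F' e' v)).trans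
        (Finset.card_le_card (Finset.filter_subset_filter _ Finset.subset_union_right))

theorem HasLower.congr {s j : ℕ} (h : HasLower V s j) (e : V ≃ W) : HasLower W s j := by
  obtain ⟨F, hF, hc, hdeg⟩ := h
  refine ⟨F.image (Finset.map e.toEmbedding), isLowerSet_image_map hF _,
    Finset.card_image_le.trans hc, fun w => ?_⟩
  have := (hdeg (e.symm w)).trans (degree_le_degree_image_map F e.toEmbedding _)
  simpa using this

/-- The families sit on the first n₁ and the last n₂ points; overlap is harmless. -/
theorem HasLower.fin_add {n₁ n₂ n s j₁ j₂ : ℕ} (h₁ : HasLower (Fin n₁) s j₁)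
    (h₂ : HasLower (Fin n₂) s j₂) (hn₁ : n₁ ≤ n) (hn₂ : n₂ ≤ n) (hn : n ≤ n₁ + n₂) :
    HasLower (Fin n) s (j₁ + j₂) := by
  have hinj : Function.Injective fun i : Fin n₂ => (⟨n - n₂ + i, by omega⟩ : Fin n) :=
    fun i i' hii => by
      simp only [Fin.mk.injEq] at hii
      omega
  refine h₁.union h₂ (Fin.castLEEmb hn₁) ⟨_, hinj⟩ fun w => ?_
  by_cases hw : w.1 < n₁
  · exact Or.inl ⟨⟨w, hw⟩, rfl⟩
  · refine Or.inr ⟨⟨w - (n - n₂), by omega⟩, ?_⟩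
    ext
    simp only [Function.Embedding.coeFn_mk]
    omega

end Transport

/-! ### Existence of the limit and bounds for it -/

theorem card_univ_filter_mem {n : ℕ} (x : Fin n) :
    ((Finset.univ : Finset (Finset (Fin n))).filter (x ∈ ·)).card = 2 ^ (n - 1) := by
  have := card_powerset_filter_mem (Finset.mem_univ x)
  rwa [Finset.powerset_univ, Finset.card_univ, Fintype.card_fin] at this

theorem hasLower_fin_maxArrow {n s : ℕ} (hn : s + 2 ≤ n) : HasLower (Fin n) s (maxArrow n s) := by
  refine hasLower_maxArrow ?_
  have h : HasLower (Fin n) s (2 ^ n - 1) := by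
    refine ⟨Finset.univ, fun _ _ _ _ => Finset.mem_coe.2 (Finset.mem_univ _), ?_, fun x => ?_⟩
    · rw [Finset.card_univ, Fintype.card_finset, Fintype.card_fin]
      omega
    · rw [card_univ_filter_mem]
      have h1 : s + 1 < 2 ^ (s + 1) := Nat.lt_two_pow_self
      have h2 : 2 ^ (s + 1) ≤ 2 ^ (n - 1) := Nat.pow_le_pow_right (by norm_num) (by omega)
      omega
  have h1 := maxArrow_le_of_hasLower (by omega) h
  have h2 : 0 < 2 ^ n := by positivity
  omega

/-- The shift by s + 2 keeps the maximum below the cap `2 ^ n`, where lower families realise it; the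
two ground sets overlap in s + 2 points. -/
theorem subadditive_maxArrow (s : ℕ) :
    Subadditive fun n : ℕ => (maxArrow (n + (s + 2)) s : ℝ) := by
  intro m n
  have h := maxArrow_le_of_hasLower (by omega)
    ((hasLower_fin_maxArrow (n := m + (s + 2)) (s := s) (by omega)).fin_add
    (hasLower_fin_maxArrow (n := n + (s + 2)) (s := s) (by omega)) (n := m + n + (s + 2))
    (by omega) (by omega) (by omega))
  show (maxArrow (m + n + (s + 2)) s : ℝ) ≤ maxArrow (m + (s + 2)) s + maxArrow (n + (s + 2)) s
  exact_mod_cast h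

theorem tendsto_arrowLimit (s : ℕ) :
    Tendsto (fun n : ℕ => (maxArrow n s : ℝ) / (n : ℝ)) atTop (𝓝 (arrowLimit s)) := by
  have hsub := subadditive_maxArrow s
  have hlim := hsub.tendsto_lim ⟨0, by rintro _ ⟨n, rfl⟩; positivity⟩
  refine tendsto_nhds_limUnder ⟨hsub.lim, ?_⟩
  rw [← tendsto_add_atTop_iff_nat (s + 2)]
  have h1 : Tendsto (fun n : ℕ => (n : ℝ) / (n + ((s + 2 : ℕ) : ℝ))) atTop (𝓝 1) :=
    tendsto_natCast_div_add_atTop _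
  have h2 := hlim.mul h1
  rw [mul_one] at h2
  refine h2.congr' ((eventually_ne_atTop 0).mono fun n hn => ?_)
  have hn' : (n : ℝ) ≠ 0 := by exact_mod_cast hn
  push_cast
  field_simp

theorem arrowLimit_le_of_hasLower {n s j : ℕ} (hn : 1 ≤ n) (h : HasLower (Fin n) s j) :
    arrowLimit s ≤ (j : ℝ) / n := by
  have hk : ∀ k : ℕ, HasLower (Fin (k * n)) s (k * j) := fun k => by
    induction k with
    | zero =>
      rw [zero_mul]
      exact ⟨∅, by simp [IsLowerSet], by simp, fun x => x.elim0⟩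
    | succ k ih =>
      rw [add_mul k 1 j, one_mul]
      exact ih.fin_add h (Nat.mul_le_mul_right n (by omega)) (Nat.le_mul_of_pos_left n (by omega))
        (by rw [add_mul, one_mul])
  have htend := (tendsto_arrowLimit s).comp
    (tendsto_atTop_mono (fun k => Nat.le_mul_of_pos_right k hn) tendsto_id)
  refine le_of_tendsto htend ((eventually_ge_atTop 1).mono fun k hk1 => ?_)
  have h1 : maxArrow (k * n) s ≤ k * j := maxArrow_le_of_hasLower (Nat.mul_pos hk1 hn) (hk k)
  have h2 : (maxArrow (k * n) s : ℝ) ≤ k * j := by exact_mod_cast h1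
  have hn' : (0 : ℝ) < n := by exact_mod_cast hn
  have hk' : (0 : ℝ) < k := by exact_mod_cast hk1
  simp only [Function.comp_apply]
  push_cast
  rw [div_le_div_iff₀ (by positivity) hn']
  nlinarith

theorem le_arrowLimit {s : ℕ} {t : ℝ}
    (h : ∀ n j : ℕ, 1 ≤ n → HasLower (Fin n) s j → n * t ≤ j) : t ≤ arrowLimit s := by
  refine ge_of_tendsto (tendsto_arrowLimit s) ((eventually_ge_atTop (s + 2)).mono fun n hn => ?_)
  have hn' : (0 : ℝ) < n := by exact_mod_cast (show 0 < n by omega)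
  rw [le_div_iff₀ hn', mul_comm]
  exact h n _ (by omega) (hasLower_fin_maxArrow hn)

/-! ### The value of the limit for c < d -/

theorem exists_log_bound {d : ℕ} (hd : 50 ≤ d) : ∃ l, 1 ≤ l ∧ 7 * l + 2 ≤ d ∧ d ≤ 2 ^ l + 1 := by
  obtain ⟨k, hk⟩ : ∃ k, k = Nat.log 2 (d - 2) := ⟨_, rfl⟩
  have h1 : 2 ^ k ≤ d - 2 := hk ▸ Nat.pow_log_le_self 2 (by omega)
  have h2 : d - 2 < 2 ^ (k + 1) := hk ▸ Nat.lt_pow_succ_log_self (by norm_num) (d - 2)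
  refine ⟨k + 1, by omega, ?_, by omega⟩
  rcases le_or_gt k 5 with h | h
  · omega
  · have h3 : ∀ m : ℕ, 7 * (6 + m + 1) ≤ 2 ^ (6 + m) := fun m => by
      induction m with
      | zero => norm_num
      | succ m ih => rw [← add_assoc, pow_succ]; omega
    have := h3 (k - 6)
    rw [show 6 + (k - 6) = k by omega] at this
    omega

theorem le_arrowLimit_two_pow_sub {d c : ℕ} (hd : 50 ≤ d) (hc1 : 1 ≤ c) (hcd : c + 1 ≤ d) :
    ((2 : ℝ) ^ d - c) / d ≤ arrowLimit (2 ^ (d - 1) - c) := by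
  obtain ⟨l, hl1, hl, hlp⟩ := exists_log_bound hd
  refine le_arrowLimit fun n j hn ⟨F, hF, hFc, hdeg⟩ => ?_
  -- Degrees exceed s strictly, hence c - 1 rather than c.
  have h : IsDense F d (c - 1) l :=
    ⟨hF, fun x => by have := hdeg x; omega, hd, by omega, hl1, hl, hlp⟩
  have h1 := h.card_mul_le
  have hempty : ∅ ∈ F :=
    hF (Finset.empty_subset {(⟨0, hn⟩ : Fin n)}) (h.singleton_mem ⟨0, hn⟩)
  have h2 : (F.erase ∅).card ≤ j := by
    rw [Finset.card_erase_of_mem hempty]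
    omega
  have h3 : ((F.erase ∅).card : ℝ) ≤ j := by exact_mod_cast h2
  rw [Fintype.card_fin, Nat.cast_sub hc1, Nat.cast_one] at h1
  rw [show (2 : ℝ) ^ d - c = 2 ^ d - 1 - (c - 1) by ring]
  exact h1.trans h3

/-- Removing c - 1 sets from the cube lowers each degree by at most c - 1. -/
theorem hasLower_two_pow_sub {d c : ℕ} (hc1 : 1 ≤ c) (hcd : c ≤ 2 ^ (d - 1)) :
    HasLower (Fin d) (2 ^ (d - 1) - c) (2 ^ d - c) := by
  have hp : 2 ^ (d - 1) ≤ 2 ^ d := Nat.pow_le_pow_right (by norm_num) (by omega)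
  obtain ⟨F, hF, -, -, hc⟩ := exists_lower_between (L₁ := ∅)
    (L₂ := (Finset.univ : Finset (Finset (Fin d)))) (k := 2 ^ d - c + 1) (by simp [IsLowerSet])
    (fun _ _ _ _ => Finset.mem_coe.2 (Finset.mem_univ _)) (Finset.empty_subset _) (by simp)
    (by rw [Finset.card_univ, Fintype.card_finset, Fintype.card_fin]; omega)
  refine ⟨F, hF, hc.le, fun x => ?_⟩
  have h1 : ((Finset.univ : Finset (Finset (Fin d))).filter (x ∈ ·)).card ≤
      (F.filter (x ∈ ·)).card + Fᶜ.card := by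
    refine (Finset.card_le_card fun A hA => ?_).trans (Finset.card_union_le _ _)
    rw [Finset.mem_filter] at hA
    rw [Finset.mem_union, Finset.mem_filter, Finset.mem_compl]
    tauto
  rw [card_univ_filter_mem, Finset.card_compl, hc, Fintype.card_finset, Fintype.card_fin] at h1
  omega

/-! ### Failure at c = d -/

/-- A lower family on `D + 1` points that misses `D + 1` sets, and only `D` of those containing
any given point other than `0`. -/
theorem exists_lower_missing (D : ℕ) : ∃ G : Finset (Finset (Fin (D + 1))),
    IsLowerSet (G : Set (Finset (Fin (D + 1)))) ∧ G.card + (D + 1) = 2 ^ (D + 1) ∧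
    (∀ v, 2 ^ D ≤ (G.filter (v ∈ ·)).card + (D + 1)) ∧
    (∀ v, v ≠ 0 → 2 ^ D ≤ (G.filter (v ∈ ·)).card + D) ∧
    ∀ S : Finset (Fin (D + 1)), S.card < D → S ∈ G := by
  -- The values of g are the missing sets: 0 lies in all of them, any other point v in all but `g
  -- v`.
  let g : Fin (D + 1) → Finset (Fin (D + 1)) := fun w =>
    if w = 0 then Finset.univ else Finset.univ.erase w
  have hg0 : g 0 = Finset.univ := if_pos rfl
  have hg : ∀ w, w ≠ 0 → g w = Finset.univ.erase w := fun w hw => if_neg hw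
  have hginj : Function.Injective g := fun v w hvw => by
    by_cases hv : v = 0 <;> by_cases hw : w = 0
    · rw [hv, hw]
    · rw [hv, hg0, hg w hw] at hvw
      exact absurd (hvw ▸ Finset.mem_univ w) (Finset.notMem_erase w _)
    · rw [hw, hg0, hg v hv] at hvw
      exact absurd (hvw ▸ Finset.mem_univ v) (Finset.notMem_erase v _)
    · rw [hg v hv, hg w hw] at hvw
      exact Finset.erase_injOn _ (Finset.mem_univ _) (Finset.mem_univ _) hvw
  set M := Finset.univ.image g with hM
  have hMc : M.card = D + 1 := by
    rw [hM, Finset.card_image_of_injective _ hginj, Finset.card_univ, Fintype.card_fin]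
  have hdeg : ∀ v, 2 ^ D ≤ (Mᶜ.filter (v ∈ ·)).card + (M.filter (v ∈ ·)).card := fun v => by
    have h := card_univ_filter_mem v
    rw [Nat.add_sub_cancel] at h
    rw [← h]
    refine (Finset.card_le_card fun A hA => ?_).trans (Finset.card_union_le _ _)
    rw [Finset.mem_filter] at hA
    rw [Finset.mem_union, Finset.mem_filter, Finset.mem_filter, Finset.mem_compl]
    tauto
  refine ⟨Mᶜ, ?_, ?_, fun v => ?_, fun v hv => ?_, fun S hS => ?_⟩
  · intro A B hBA hA
    rw [Finset.mem_coe, Finset.mem_compl] at hA ⊢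
    refine fun hB => hA ?_
    rw [hM, Finset.mem_image] at hB ⊢
    obtain ⟨w, -, rfl⟩ := hB
    by_cases hw : w = 0
    · refine ⟨0, Finset.mem_univ _, ?_⟩
      rw [hw, hg0] at hBA
      rw [hg0]
      exact (Finset.univ_subset_iff.1 hBA).symm
    · rw [hg w hw] at hBA
      by_cases hwA : w ∈ A
      · refine ⟨0, Finset.mem_univ _, ?_⟩
        rw [hg0]
        refine (Finset.eq_univ_of_forall fun y => ?_).symm
        by_cases hy : y = w
        · exact hy ▸ hwA
        · exact hBA (Finset.mem_erase.2 ⟨hy, Finset.mem_univ y⟩)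
      · refine ⟨w, Finset.mem_univ _, ?_⟩
        rw [hg w hw]
        exact Finset.Subset.antisymm hBA fun y hy =>
          Finset.mem_erase.2 ⟨fun e => hwA (e ▸ hy), Finset.mem_univ y⟩
  · have := Finset.card_add_card_compl M
    rw [Fintype.card_finset, Fintype.card_fin] at this
    omega
  · have := hdeg v
    have := Finset.card_filter_le M (v ∈ ·)
    omega
  · have h1 := hdeg v
    have h2 : M.filter (v ∈ ·) ⊆ M.erase (g v) := fun A hA => by
      rw [Finset.mem_filter] at hA
      refine Finset.mem_erase.2 ⟨fun e => ?_, hA.1⟩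
      rw [e, hg v hv] at hA
      exact Finset.notMem_erase v _ hA.2
    have h3 := Finset.card_le_card h2
    have hgM : g v ∈ M := Finset.mem_image_of_mem g (Finset.mem_univ v)
    rw [Finset.card_erase_of_mem hgM] at h3
    omega
  · rw [Finset.mem_compl, hM, Finset.mem_image]
    rintro ⟨w, -, rfl⟩
    by_cases hw : w = 0
    · rw [hw, hg0, Finset.card_univ, Fintype.card_fin] at hS
      omega
    · rw [hg w hw, Finset.card_erase_of_mem (Finset.mem_univ w), Finset.card_univ,
        Fintype.card_fin] at hS
      omega

/-- Two blocks joined by an edge. -/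
theorem hasLower_two_blocks {D : ℕ} (hD : 2 ≤ D) (hD2 : D + 1 ≤ 2 ^ D) :
    HasLower (Fin (D + 1) ⊕ Fin (D + 1)) (2 ^ D - (D + 1)) (2 * (2 ^ (D + 1) - (D + 1)) - 1) := by
  obtain ⟨G, hG, hGc, hdeg, hdeg0, hsmall⟩ := exists_lower_missing D
  set G₁ := G.image (Finset.map (Function.Embedding.inl (α := Fin (D + 1)) (β := Fin (D + 1))))
    with hG₁
  set G₂ := G.image (Finset.map (Function.Embedding.inr (α := Fin (D + 1)) (β := Fin (D + 1))))
    with hG₂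
  -- Only the two copies of 0 are short, by one each, so a single edge repairs both. This saves one
  -- set against two separate cubes with d - 1 sets removed from each.
  set E : Finset (Fin (D + 1) ⊕ Fin (D + 1)) := {Sum.inl 0, Sum.inr 0} with hE
  have h0 : ({0} : Finset (Fin (D + 1))) ∈ G := hsmall _ (by simp; omega)
  have hE₁ : E ∉ G₁ := fun h => by
    obtain ⟨A, -, hA⟩ := Finset.mem_image.1 h
    have : Sum.inr 0 ∈ E := by simp [hE]
    rw [← hA] at this
    simp at this
  have hE₂ : E ∉ G₂ := fun h => by
    obtain ⟨A, -, hA⟩ := Finset.mem_image.1 h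
    have : Sum.inl 0 ∈ E := by simp [hE]
    rw [← hA] at this
    simp at this
  have hpow : 2 ^ (D + 1) = 2 ^ D * 2 := pow_succ 2 D
  refine ⟨insert E (G₁ ∪ G₂), ?_, ?_, ?_⟩
  · intro A B hBA hA
    rw [Finset.mem_coe, Finset.mem_insert, Finset.mem_union] at hA ⊢
    rcases hA with rfl | hA | hA
    · by_cases h1 : Sum.inl 0 ∈ B <;> by_cases h2 : Sum.inr 0 ∈ B
      · exact Or.inl (Finset.Subset.antisymm hBA
          (Finset.insert_subset h1 (Finset.singleton_subset_iff.2 h2)))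
      · refine Or.inr (Or.inl (isLowerSet_image_map hG _ (?_ : B ≤ {Sum.inl 0})
          (Finset.mem_image.2 ⟨{0}, h0, by simp⟩)))
        intro z hz
        rcases Finset.mem_insert.1 (hBA hz) with rfl | hz'
        · simp
        · rw [Finset.mem_singleton.1 hz'] at hz
          exact absurd hz h2
      all_goals
        refine Or.inr (Or.inr (isLowerSet_image_map hG _ (?_ : B ≤ {Sum.inr 0})
          (Finset.mem_image.2 ⟨{0}, h0, by simp⟩)))
        intro z hz
        rcases Finset.mem_insert.1 (hBA hz) with rfl | hz'
        · exact absurd hz h1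
        · exact hz'
    · exact Or.inr (Or.inl (isLowerSet_image_map hG _ hBA hA))
    · exact Or.inr (Or.inr (isLowerSet_image_map hG _ hBA hA))
  · have h1 := card_union_image_map_le hG hG
      (Function.Embedding.inl (α := Fin (D + 1)) (β := Fin (D + 1)))
      (Function.Embedding.inr (α := Fin (D + 1)) (β := Fin (D + 1)))
      (j := 2 ^ (D + 1) - (D + 1) - 1) (j' := 2 ^ (D + 1) - (D + 1) - 1) (by omega) (by omega)
    have h2 := Finset.card_insert_le E (G₁ ∪ G₂)
    simp only [← hG₁, ← hG₂] at h1
    omega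
  · have key : ∀ (e : Fin (D + 1) ↪ Fin (D + 1) ⊕ Fin (D + 1)) (v : Fin (D + 1)),
        G.image (Finset.map e) ⊆ G₁ ∪ G₂ → E ∉ G.image (Finset.map e) → e 0 ∈ E →
        2 ^ D - (D + 1) + 1 ≤ ((insert E (G₁ ∪ G₂)).filter (e v ∈ ·)).card := by
      intro e v hsub hEe he0
      have h1 := degree_le_degree_image_map G e v
      by_cases hv : v = 0
      · subst hv
        have h2 : insert E ((G.image (Finset.map e)).filter (e 0 ∈ ·)) ⊆
            (insert E (G₁ ∪ G₂)).filter (e 0 ∈ ·) := by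
          refine Finset.insert_subset ?_ ?_
          · exact Finset.mem_filter.2 ⟨Finset.mem_insert_self _ _, he0⟩
          · exact Finset.filter_subset_filter _ (hsub.trans (Finset.subset_insert _ _))
        have h3 := Finset.card_le_card h2
        rw [Finset.card_insert_of_notMem fun h => hEe (Finset.mem_filter.1 h).1] at h3
        have := hdeg 0
        omega
      · have h2 := Finset.card_le_card (Finset.filter_subset_filter (e v ∈ ·)
          (hsub.trans (Finset.subset_insert E _)))
        have := hdeg0 v hv
        omega
    rintro (v | v)
    · exact key Function.Embedding.inl v Finset.subset_union_left hE₁ (by simp [hE])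
    · exact key Function.Embedding.inr v Finset.subset_union_right hE₂ (by simp [hE])

theorem arrowLimit_two_pow_sub_self_lt {d : ℕ} (hd : 50 ≤ d) :
    arrowLimit (2 ^ (d - 1) - d) < ((2 : ℝ) ^ d - d) / d := by
  obtain ⟨D, rfl⟩ : ∃ D, d = D + 1 := ⟨d - 1, by omega⟩
  rw [Nat.add_sub_cancel]
  have hD : D + 1 ≤ 2 ^ D := Nat.lt_two_pow_self
  have h := ((hasLower_two_blocks (by omega) hD).congr finSumFinEquiv)
  refine (arrowLimit_le_of_hasLower (by omega) h).trans_lt ?_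
  have hpow : 2 ^ (D + 1) = 2 ^ D * 2 := pow_succ 2 D
  rw [Nat.cast_sub (by omega), Nat.cast_mul, Nat.cast_sub (by omega),
    div_lt_div_iff₀ (by positivity) (by positivity)]
  push_cast
  nlinarith [show (0 : ℝ) ≤ D from Nat.cast_nonneg D]

theorem mainTheorem4 (d : ℕ) (hd : 50 ≤ d) :
    (∀ s : ℕ, Tendsto (fun n : ℕ => (maxArrow n s : ℝ) / (n : ℝ)) atTop (𝓝 (arrowLimit s))) ∧
    IsGreatest
      {c₀ : ℕ | ∀ c : ℕ, 1 ≤ c → c ≤ c₀ →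
        arrowLimit (2 ^ (d - 1) - c) = ((2 : ℝ) ^ d - (c : ℝ)) / (d : ℝ)}
      (d - 1) := by
  refine ⟨tendsto_arrowLimit, fun c hc1 hc => ?_, fun c₀ hc₀ => ?_⟩
  · refine le_antisymm ?_ (le_arrowLimit_two_pow_sub hd hc1 (by omega))
    have h1 : d - 1 < 2 ^ (d - 1) := Nat.lt_two_pow_self
    have h2 : 2 ^ (d - 1) ≤ 2 ^ d := Nat.pow_le_pow_right (by norm_num) (by omega)
    have h := arrowLimit_le_of_hasLower (by omega)
      (hasLower_two_pow_sub (d := d) hc1 (by omega))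
    rw [Nat.cast_sub (by omega)] at h
    exact_mod_cast h
  · by_contra! hlt
    have h := hc₀ d (by omega) (by omega)
    exact (arrowLimit_two_pow_sub_self_lt hd).ne h
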